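/- Let $n\ge 1$, $\lambda\ge 1$, $0<c\le 1$ and $d_\sigma>0$, and let $f:\mathbb{R}^n\to\mathbb{R}$, $f(x)=g(\langle a,x\rangle+b)$, with $g:\mathbb{R}\to\mathbb{R}$ strictly increasing, $a\in\mathbb{R}^n\setminus\{0\}$ and $b\in\mathbb{R}$. Let $\boldsymbol p_0$ and $\boldsymbol\xi_{t,i}$ ($t\in\mathbb{N}$, $1\le i\le\lambda$) be independent random vectors with the standard normal distribution $\mathcal N(0,I_n)$. The $(1,\lambda)$-CSA-ES minimizing $f$, started at an arbitrary (possibly random) $\boldsymbol X_0\in\mathbb{R}^n$ and $\sigma_0>0$, is the process $(\boldsymbol X_t,\sigma_t,\boldsymbol p_t)_{t\in\mathbb{N}}$ defined by $$\boldsymbol X_{t+1}=\boldsymbol X_t+\sigma_t\boldsymbol\xi_t^\star,\qquad \boldsymbol p_{t+1}=(1-c)\boldsymbol p_t+\sqrt{c(2-c)}\,\boldsymbol\xi^\star_t,\qquad \sigma_{t+1}=\sigma_t\exp\left(\frac{c}{2d_\sigma}\left(\frac{\|\boldsymbol p_{t+1}\|^2}{n}-1\right)\right),$$ where $\boldsymbol\xi^\star_t=\boldsymbol\xi_{t,i}$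 for an index $i$ that minimizes $f(\boldsymbol X_t+\sigma_t\boldsymbol\xi_{t,i})$ (ties, which have probability zero, being broken by any fixed rule that depends on the $\lambda$ objective values). Let $\mathcal N_{1:\lambda}$ be the smallest of $\lambda$ independent standard normal random variables. **Theorem.** Put $$r=\frac{1}{2d_\sigma n}\left(2(1-c)\,\mathbb{E}(\mathcal N_{1:\lambda})^2+c\left(\mathbb{E}(\mathcal N_{1:\lambda}^2)-1\right)\right).$$ Then $\frac1t\ln(\sigma_t/\sigma_0)\to r$ almost surely as $t\to\infty$; moreover $\frac1t\ln(\sigma_t/\sigma_0)$ is integrable for every $t\geq 1$, and $\mathbb{E}\left(\frac1t\ln(\sigma_t/\sigma_0)\right)\to r$. If $\lambda\ge 3$, or if $\lambda=2$ and $c<1$, then $r>0$; hence in these cases the step-size almost surely diverges geometrically, that is, $\frac1t\ln(\sigma_t/\sigma_0)$ converges to a positive constant. -/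

import Mathlib

open MeasureTheory ProbabilityTheory Filter Topology

noncomputable section

namespace CSAES

/-- State `(X_t, σ_t, p_t)` of the algorithm: parent, step-size, cumulative path. -/
structure State (n : ℕ) where
  parent : EuclideanSpace ℝ (Fin n)
  stepSize : ℝ
  path : EuclideanSpace ℝ (Fin n)

/-- A selection rule: given the objective values of the `lam` children it returns the index of
one with the lowest value (ties may be broken in any way). -/
def IsArgmin {lam : ℕ} (select : (Fin lam → ℝ) → Fin lam) : Prop :=
  ∀ (v : Fin lam → ℝ) (j : Fin lam), v (select v) ≤ v j

variable {n lam : ℕ}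

/-- The selected step: the random step `ξ i` of the best child `X + σ ξ i`. -/
def selectedStep (f : EuclideanSpace ℝ (Fin n) → ℝ) (select : (Fin lam → ℝ) → Fin lam)
    (s : State n) (ξ : Fin lam → EuclideanSpace ℝ (Fin n)) : EuclideanSpace ℝ (Fin n) :=
  ξ (select fun i => f (s.parent + s.stepSize • ξ i))

/-- The update `p' = (1 - c) p + √(c (2 - c)) ξ⋆` of the cumulative path. -/
def pathUpdate (c : ℝ) (p ξstar : EuclideanSpace ℝ (Fin n)) : EuclideanSpace ℝ (Fin n) :=
  (1 - c) • p + Real.sqrt (c * (2 - c)) • ξstar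

/-- The step-size change `exp (c / (2 d) (‖p‖² / n - 1))`. -/
def stepSizeChange (c d : ℝ) (p : EuclideanSpace ℝ (Fin n)) : ℝ :=
  Real.exp (c / (2 * d) * (‖p‖ ^ 2 / n - 1))

/-- One iteration of the `(1, lam)`-CSA-ES minimizing `f`, with cumulation parameter `c`
and damping `d`, from the random steps `ξ 1, …, ξ lam`. -/
def step (f : EuclideanSpace ℝ (Fin n) → ℝ) (select : (Fin lam → ℝ) → Fin lam) (c d : ℝ)
    (s : State n) (ξ : Fin lam → EuclideanSpace ℝ (Fin n)) : State n where
  parent := s.parent + s.stepSize • selectedStep f select s ξ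
  stepSize := s.stepSize * stepSizeChange c d (pathUpdate c s.path (selectedStep f select s ξ))
  path := pathUpdate c s.path (selectedStep f select s ξ)

/-- The state after `t` iterations, from the initial state `s₀` and the random steps
`ξ t i` (iteration `t`, child `i`). -/
def run (f : EuclideanSpace ℝ (Fin n) → ℝ) (select : (Fin lam → ℝ) → Fin lam) (c d : ℝ)
    (s₀ : State n) (ξ : ℕ → Fin lam → EuclideanSpace ℝ (Fin n)) : ℕ → State n
  | 0 => s₀
  | t + 1 => step f select c d (run f select c d s₀ ξ t) (ξ t)

/-- The law of `N_{1:lam}`, the smallest of `lam` independent standard normal variables. -/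
def minNormalLaw (lam : ℕ) : Measure ℝ :=
  (Measure.pi fun _ : Fin lam => gaussianReal 0 1).map fun v => ⨅ i, v i

/-- The rate `(2 (1 - c) E(N_{1:lam})² + c (E(N_{1:lam}²) - 1)) / (2 d n)`. -/
def rate (n lam : ℕ) (c d : ℝ) : ℝ :=
  1 / (2 * d * n) *
    (2 * (1 - c) * (∫ x, x ∂minNormalLaw lam) ^ 2 + c * ((∫ x, x ^ 2 ∂minNormalLaw lam) - 1))

/-- A sequence of positive reals diverges geometrically: `(1 / t) ln (s t / s 0)` converges to a
positive constant. -/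
def GeometricallyDivergent (s : ℕ → ℝ) : Prop :=
  ∃ r : ℝ, 0 < r ∧ Tendsto (fun t : ℕ => 1 / (t : ℝ) * Real.log (s t / s 0)) atTop (𝓝 r)

end CSAES

end

/-! On a strictly increasing function of an affine form, the child with the lowest objective value
is, for every state with positive step-size, the child whose step has the smallest inner product
with `a`. Outside a null set of ties the selected steps are therefore i.i.d. and do not depend on
`X_t` or `σ_t`. The path is then a linear recursion driven by i.i.d. noise, and `ln (σ_t / σ_0)` is
an explicit sum of its squared norms (`selectedStep_eq_bestStep`, `log_stepSize_div`).

The average of `‖p_t‖²` comes from an exact identity (`sum_sq_norm_cumulativePath`), obtained by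
expanding the recursion and telescoping. It consists of boundary terms, which are `o(T)`; the sum of
`⟪p_t, η_t - m⟫` with `m = E η`, a sum of orthogonal increments with bounded variance, killed by a
second-moment law of large numbers (`ae_tendsto_average_zero`); and averages of `η_t` and `‖η_t‖²`,
handled by the classical strong law. Integrating the same identity gives convergence in expectation.

The moments of the selected step follow in an orthonormal basis containing `a / ‖a‖`: the coordinate
along `a` is distributed as `N_{1:lam}`, while the others are independent of the selection and keep
standard normal moments.

Positivity rests on `E N_{1:lam} < 0` for `lam ≥ 2` and on `E N_{1:lam}² ≥ 1`, strict for `lam ≥ 3`.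
The latter compares the tails of `N_{1:lam}²` pointwise with those of a single squared normal. -/

noncomputable section

namespace CSAES

set_option linter.unusedSectionVars false

/-! ### A second-moment strong law of large numbers -/

section Averages

variable {Ω : Type*} [MeasurableSpace Ω] {P : Measure Ω}

/-- A sequence of random variables with summable second moments tends to zero almost surely. -/
theorem ae_tendsto_zero_of_summable_integral_sq {F : ℕ → Ω → ℝ} (hF : ∀ k, MemLp (F k) 2 P)
    (hsum : Summable fun k => ∫ ω, F k ω ^ 2 ∂P) :
    ∀ᵐ ω ∂P, Tendsto (fun k => F k ω) atTop (𝓝 0) := by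
  have hint : ∀ k, Integrable (fun ω => F k ω ^ 2) P := fun k => (hF k).integrable_sq
  have hfin : ∫⁻ ω, ∑' k, ENNReal.ofReal (F k ω ^ 2) ∂P ≠ ⊤ := by
    rw [lintegral_tsum fun k => (hint k).aemeasurable.ennreal_ofReal]
    have : ∀ k, ∫⁻ ω, ENNReal.ofReal (F k ω ^ 2) ∂P = ENNReal.ofReal (∫ ω, F k ω ^ 2 ∂P) :=
      fun k => (ofReal_integral_eq_lintegral_ofReal (hint k)
        (ae_of_all _ fun ω => sq_nonneg _)).symm
    simp_rw [this]
    exact hsum.tsum_ofReal_ne_top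
  have hae := ae_lt_top' (AEMeasurable.tsum
    fun k => (hint k).aemeasurable.ennreal_ofReal) hfin
  filter_upwards [hae] with ω hω
  have h1 := ENNReal.tendsto_atTop_zero_of_tsum_ne_top hω.ne
  have h2 : Tendsto (fun k => F k ω ^ 2) atTop (𝓝 0) := by
    have := (ENNReal.tendsto_toReal ENNReal.zero_ne_top).comp h1
    simpa [Function.comp_def, ENNReal.toReal_ofReal (sq_nonneg _)] using this
  have h3 := h2.sqrt
  simp only [Real.sqrt_sq_eq_abs, Real.sqrt_zero] at h3
  exact (tendsto_zero_iff_abs_tendsto_zero _).2 h3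

/-- A strong law of large numbers: if the partial sums of square integrable variables grow at most
linearly in mean square, then the averages tend to zero almost surely. -/
theorem ae_tendsto_average_zero {D : ℕ → Ω → ℝ} {C : ℝ} (hD : ∀ t, MemLp (D t) 2 P)
    (hC : ∀ t, ∫ ω, D t ω ^ 2 ∂P ≤ C)
    (hS : ∀ T : ℕ, ∫ ω, (∑ t ∈ Finset.range T, D t ω) ^ 2 ∂P ≤ C * T) :
    ∀ᵐ ω ∂P, Tendsto (fun T : ℕ => (∑ t ∈ Finset.range T, D t ω) / T) atTop (𝓝 0) := by
  have hC0 : 0 ≤ C := (integral_nonneg fun ω => sq_nonneg (D 0 ω)).trans (hC 0)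
  have hsumm : ∀ K : ℝ, Summable fun k : ℕ => K / (k : ℝ) ^ 2 := fun K => by
    simpa [div_eq_mul_inv] using (Real.summable_nat_pow_inv.2 one_lt_two).mul_left K
  -- Along the squares `T = k²` the mean square of the average is at most `C / k²`, which is
  -- summable. The case `k = 0` is harmless because division by zero gives zero.
  have hA : ∀ᵐ ω ∂P, Tendsto (fun k : ℕ => (∑ t ∈ Finset.range (k ^ 2), D t ω) / (k : ℝ) ^ 2)
      atTop (𝓝 0) := by
    refine ae_tendsto_zero_of_summable_integral_sq (fun k => ?_) ?_
    · simpa [div_eq_inv_mul] using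
        (memLp_finsetSum (Finset.range (k ^ 2)) fun t _ => hD t).const_mul ((k : ℝ) ^ 2)⁻¹
    · refine (hsumm C).of_nonneg_of_le (fun k => integral_nonneg fun ω => sq_nonneg _) fun k => ?_
      simp_rw [div_pow]
      rw [integral_div]
      rcases Nat.eq_zero_or_pos k with rfl | hk
      · simp
      have hk' : (0 : ℝ) < k := by exact_mod_cast hk
      rw [div_le_div_iff₀ (by positivity) (by positivity)]
      have := hS (k ^ 2)
      push_cast at this
      nlinarith [mul_le_mul_of_nonneg_right this (sq_nonneg (k : ℝ))]
  -- Fluctuation between consecutive squares: a block has `2k + 1` terms, so Cauchy–Schwarz bounds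
  -- its mean square by `(2k + 1)² C ≤ 9 C k²` for `k ≥ 1`.
  have hB : ∀ᵐ ω ∂P, Tendsto (fun k : ℕ => (∑ t ∈ Finset.Ico (k ^ 2) ((k + 1) ^ 2), |D t ω|) /
      (k : ℝ) ^ 2) atTop (𝓝 0) := by
    refine ae_tendsto_zero_of_summable_integral_sq (fun k => ?_) ?_
    · simpa [div_eq_inv_mul] using
        (memLp_finsetSum (Finset.Ico (k ^ 2) ((k + 1) ^ 2)) fun t _ => (hD t).abs).const_mul
          ((k : ℝ) ^ 2)⁻¹
    · refine (hsumm (9 * C)).of_nonneg_of_le (fun k => integral_nonneg fun ω => sq_nonneg _)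
        fun k => ?_
      simp_rw [div_pow]
      rw [integral_div]
      rcases Nat.eq_zero_or_pos k with rfl | hk
      · simp
      have hk' : (1 : ℝ) ≤ k := by exact_mod_cast hk
      have hcard : ((Finset.Ico (k ^ 2) ((k + 1) ^ 2)).card : ℝ) = 2 * k + 1 := by
        rw [Nat.card_Ico, Nat.cast_sub (Nat.pow_le_pow_left (Nat.le_succ k) 2)]
        push_cast
        ring
      have hle : ∫ ω, (∑ t ∈ Finset.Ico (k ^ 2) ((k + 1) ^ 2), |D t ω|) ^ 2 ∂P ≤
          (2 * k + 1) * ((2 * k + 1) * C) := by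
        calc _ ≤ ∫ ω, (2 * k + 1) * ∑ t ∈ Finset.Ico (k ^ 2) ((k + 1) ^ 2), D t ω ^ 2 ∂P := by
              refine integral_mono (memLp_finsetSum (Finset.Ico (k ^ 2) ((k + 1) ^ 2))
                fun t _ => (hD t).abs).integrable_sq
                ((integrable_finsetSum _ fun t _ => (hD t).integrable_sq).const_mul _) fun ω => ?_
              have := sq_sum_le_card_mul_sum_sq (s := Finset.Ico (k ^ 2) ((k + 1) ^ 2))
                (f := fun t => |D t ω|)
              simpa only [hcard, sq_abs] using this
          _ = (2 * k + 1) * ∑ t ∈ Finset.Ico (k ^ 2) ((k + 1) ^ 2), ∫ ω, D t ω ^ 2 ∂P := by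
              rw [integral_const_mul, integral_finsetSum _ fun t _ => (hD t).integrable_sq]
          _ ≤ (2 * k + 1) * ((2 * k + 1) * C) := by
              gcongr
              rw [← hcard, ← nsmul_eq_mul]
              exact Finset.sum_le_card_nsmul _ _ _ fun t _ => hC t
      rw [div_le_div_iff₀ (by positivity) (by positivity)]
      have h9 : (2 * (k : ℝ) + 1) * ((2 * k + 1) * C) ≤ 9 * C * k ^ 2 := by
        have : (2 * (k : ℝ) + 1) * (2 * k + 1) ≤ 9 * k ^ 2 := by nlinarith
        nlinarith
      nlinarith [mul_le_mul_of_nonneg_right (hle.trans h9) (sq_nonneg (k : ℝ))]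
  have hsqrt : Tendsto Nat.sqrt atTop atTop :=
    tendsto_atTop_atTop.2 fun b => ⟨b * b, fun a h => Nat.le_sqrt.2 h⟩
  filter_upwards [hA, hB] with ω hAω hBω
  have hlim : Tendsto (fun k : ℕ => |(∑ t ∈ Finset.range (k ^ 2), D t ω) / (k : ℝ) ^ 2| +
      (∑ t ∈ Finset.Ico (k ^ 2) ((k + 1) ^ 2), |D t ω|) / (k : ℝ) ^ 2) atTop (𝓝 0) := by
    simpa using hAω.abs.add hBω
  refine squeeze_zero_norm' ?_ (hlim.comp hsqrt)
  filter_upwards [eventually_ge_atTop 1] with T hT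
  have hk1 : T.sqrt ^ 2 ≤ T := Nat.sqrt_le' T
  have hk2 : T < (T.sqrt + 1) ^ 2 := Nat.lt_succ_sqrt' T
  have hk0 : 0 < T.sqrt := Nat.sqrt_pos.2 hT
  simp only [Function.comp_apply]
  set k := T.sqrt
  have hk0' : (0 : ℝ) < (k : ℝ) ^ 2 := by positivity
  have hkT : (k : ℝ) ^ 2 ≤ T := by exact_mod_cast hk1
  rw [abs_div, abs_of_pos hk0', ← add_div, Real.norm_eq_abs, abs_div,
    Nat.abs_cast]
  have hnum : |∑ t ∈ Finset.range T, D t ω| ≤ |∑ t ∈ Finset.range (k ^ 2), D t ω| +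
      ∑ t ∈ Finset.Ico (k ^ 2) ((k + 1) ^ 2), |D t ω| := by
    rw [← Finset.sum_range_add_sum_Ico _ hk1]
    refine (abs_add_le _ _).trans (add_le_add le_rfl ?_)
    refine (Finset.abs_sum_le_sum_abs _ _).trans ?_
    exact Finset.sum_le_sum_of_subset_of_nonneg (Finset.Ico_subset_Ico_right hk2.le)
      fun _ _ _ => abs_nonneg _
  exact div_le_div₀ (by positivity) hnum hk0' hkT

end Averages

/-- A nonnegative sequence which contracts up to a vanishing error tends to zero. -/
theorem tendsto_zero_of_le_mul_add {r e : ℕ → ℝ} {q : ℝ} (hq0 : 0 ≤ q) (hq1 : q < 1)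
    (hr : ∀ t, 0 ≤ r t) (hrec : ∀ t, r (t + 1) ≤ q * r t + e t)
    (he : Tendsto e atTop (𝓝 0)) : Tendsto r atTop (𝓝 0) := by
  rw [Metric.tendsto_atTop]
  intro ε hε
  -- With this bound on the error, `ε / 2` is the fixed point of `x ↦ q x + (1 - q) ε / 2`, so the
  -- excess of `r` over `ε / 2` contracts by `q`.
  have hev := (he.eventually (gt_mem_nhds (show 0 < (1 - q) * (ε / 2) by
    have := sub_pos.2 hq1
    positivity)))
  obtain ⟨N, hN⟩ := eventually_atTop.1 hev
  have hgeo : ∀ k, r (N + k) - ε / 2 ≤ q ^ k * r N := by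
    intro k
    induction k with
    | zero => simp; linarith
    | succ k ih =>
      have h1 := hrec (N + k)
      have h2 := hN (N + k) (Nat.le_add_right N k)
      rw [← add_assoc, pow_succ']
      nlinarith [mul_le_mul_of_nonneg_left ih hq0]
  have hpow : Tendsto (fun k => q ^ k * r N) atTop (𝓝 0) := by
    simpa using (tendsto_pow_atTop_nhds_zero_of_lt_one hq0 hq1).mul_const (r N)
  obtain ⟨K, hK⟩ := eventually_atTop.1 (hpow.eventually (gt_mem_nhds (half_pos hε)))
  refine ⟨N + K, fun n hn => ?_⟩
  obtain ⟨k, rfl⟩ := Nat.exists_eq_add_of_le (le_of_add_le_left hn)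
  have h1 := hgeo k
  have h2 := hK k (by omega)
  rw [Real.dist_eq, sub_zero, abs_of_nonneg (hr _)]
  linarith

/-! ### Pathwise identities and bounds for the cumulative path -/

section Path

variable {E : Type*} [NormedAddCommGroup E] [InnerProductSpace ℝ E]

theorem sq_inner_le (x y : E) : inner ℝ x y ^ 2 ≤ ‖x‖ ^ 2 * ‖y‖ ^ 2 := by
  rw [← mul_pow, ← sq_abs]
  exact pow_le_pow_left₀ (abs_nonneg _) (abs_real_inner_le_norm x y) 2

theorem abs_inner_le (x y : E) : |inner ℝ x y| ≤ ‖x‖ ^ 2 + ‖y‖ ^ 2 := by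
  have h1 := abs_real_inner_le_norm x y
  nlinarith [sq_nonneg (‖x‖ - ‖y‖), sq_nonneg ‖x‖, sq_nonneg ‖y‖]

/-- The cumulative path driven by the selected steps `η`. -/
def cumulativePath (c : ℝ) (p : E) (η : ℕ → E) : ℕ → E
  | 0 => p
  | t + 1 => (1 - c) • cumulativePath c p η t + Real.sqrt (c * (2 - c)) • η t

theorem cumulativePath_succ (c : ℝ) (p : E) (η : ℕ → E) (t : ℕ) :
    cumulativePath c p η (t + 1) =
      (1 - c) • cumulativePath c p η t + Real.sqrt (c * (2 - c)) • η t := rfl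

variable {c : ℝ}

theorem sq_sqrt_cumulation (hc0 : 0 < c) (hc1 : c ≤ 1) :
    Real.sqrt (c * (2 - c)) ^ 2 = c * (2 - c) :=
  Real.sq_sqrt (mul_nonneg hc0.le (by linarith))

/-- The summed squared norms of the path: boundary terms, the sum of `⟪p t, η t - m⟫`, and sums of
functions of the steps. -/
theorem sum_sq_norm_cumulativePath (hc0 : 0 < c) (hc1 : c ≤ 1) (p m : E) (η : ℕ → E) (T : ℕ) :
    c * (2 - c) * ∑ t ∈ Finset.range T, ‖cumulativePath c p η (t + 1)‖ ^ 2 =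
      (1 - c) ^ 2 * (‖p‖ ^ 2 - ‖cumulativePath c p η T‖ ^ 2) +
      2 * (1 - c) * Real.sqrt (c * (2 - c)) *
        ∑ t ∈ Finset.range T, inner ℝ (cumulativePath c p η t) (η t - m) +
      2 * (1 - c) * Real.sqrt (c * (2 - c)) / c *
        (inner ℝ m p - inner ℝ m (cumulativePath c p η T)) +
      c * (2 - c) * (2 * (1 - c) / c * inner ℝ m (∑ t ∈ Finset.range T, η t) +
        ∑ t ∈ Finset.range T, ‖η t‖ ^ 2) := by
  -- Behind the identity: `1 - (1 - c)² = c (2 - c)` turns the squared recursion into a telescoping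
  -- sum. In the cross term, `η t` is split as `(η t - m) + m`, and the sum of `⟪m, p t⟫` is
  -- eliminated by telescoping `c ⟪m, p t⟫ = ⟪m, p t⟫ - ⟪m, p (t + 1)⟫ + √(c (2 - c)) ⟪m, η t⟫`.
  induction T with
  | zero => simp [cumulativePath]
  | succ T ih =>
    simp only [Finset.sum_range_succ, mul_add, ih]
    have hκ := sq_sqrt_cumulation hc0 hc1
    rw [cumulativePath_succ]
    set κ := Real.sqrt (c * (2 - c))
    set x := cumulativePath c p η T
    have hnorm : ‖(1 - c) • x + κ • η T‖ ^ 2 =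
        (1 - c) ^ 2 * ‖x‖ ^ 2 + 2 * (1 - c) * κ * inner ℝ x (η T) + κ ^ 2 * ‖η T‖ ^ 2 := by
      rw [norm_add_sq_real, norm_smul, norm_smul, inner_smul_left, inner_smul_right, mul_pow,
        mul_pow, Real.norm_eq_abs, Real.norm_eq_abs, sq_abs, sq_abs]
      simp
      ring
    rw [hnorm, inner_add_right, inner_add_right, inner_smul_right, inner_smul_right,
      inner_sub_right, real_inner_comm m x, hκ]
    field_simp
    linear_combination (2 * (1 - c) * inner ℝ m (η T)) * hκ

/-- One step of the path is a convex combination. -/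
theorem sq_norm_cumulativePath_succ_le (hc0 : 0 < c) (hc1 : c ≤ 1) (p : E) (η : ℕ → E) (t : ℕ) :
    ‖cumulativePath c p η (t + 1)‖ ^ 2 ≤
      (1 - c) * ‖cumulativePath c p η t‖ ^ 2 + (2 - c) * ‖η t‖ ^ 2 := by
  rw [cumulativePath_succ]
  have hκ := sq_sqrt_cumulation hc0 hc1
  have hκ0 := Real.sqrt_nonneg (c * (2 - c))
  set κ := Real.sqrt (c * (2 - c))
  have h1 : ‖(1 - c) • cumulativePath c p η t + κ • η t‖ ≤
      (1 - c) * ‖cumulativePath c p η t‖ + κ * ‖η t‖ := by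
    refine (norm_add_le _ _).trans_eq ?_
    rw [norm_smul, norm_smul, Real.norm_of_nonneg hκ0, Real.norm_of_nonneg (by linarith)]
  set x := ‖cumulativePath c p η t‖
  set y := ‖η t‖
  have hx : 0 ≤ x := norm_nonneg _
  have hy : 0 ≤ y := norm_nonneg _
  calc _ ≤ ((1 - c) * x + κ * y) ^ 2 := pow_le_pow_left₀ (norm_nonneg _) h1 2
    _ ≤ (1 - c) * x ^ 2 + (2 - c) * y ^ 2 := by
      -- Convexity of the square with weights `1 - c`, `c` at the points `x` and `κ y / c`; the
      -- Jensen gap is written as a square after clearing the denominator `c`.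
      have h2 : c * ((1 - c) * x ^ 2 + (2 - c) * y ^ 2 - ((1 - c) * x + κ * y) ^ 2) =
          (1 - c) * (c * x - κ * y) ^ 2 := by
        linear_combination (-y ^ 2) * hκ
      have h3 : 0 ≤ c * ((1 - c) * x ^ 2 + (2 - c) * y ^ 2 - ((1 - c) * x + κ * y) ^ 2) := by
        rw [h2]
        have : 0 ≤ 1 - c := by linarith
        positivity
      have := nonneg_of_mul_nonneg_right h3 hc0
      linarith

/-- If the squared steps are `o(t)` then so are the squared norms of the path. -/
theorem tendsto_sq_norm_cumulativePath_div (hc0 : 0 < c) (hc1 : c ≤ 1) (p : E) (η : ℕ → E)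
    (hη : Tendsto (fun t : ℕ => ‖η t‖ ^ 2 / (t + 1 : ℝ)) atTop (𝓝 0)) :
    Tendsto (fun t : ℕ => ‖cumulativePath c p η t‖ ^ 2 / t) atTop (𝓝 0) := by
  rw [← tendsto_add_atTop_iff_nat 1]
  -- The denominator `t + 1` never vanishes and increases, so the normalized norms inherit the
  -- contraction by `1 - c`.
  have key : Tendsto (fun t : ℕ => ‖cumulativePath c p η t‖ ^ 2 / (t + 1 : ℝ)) atTop (𝓝 0) := by
    refine tendsto_zero_of_le_mul_add (q := 1 - c)
      (e := fun t => (2 - c) * (‖η t‖ ^ 2 / (t + 1 : ℝ))) (by linarith) (by linarith)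
      (fun t => by positivity) (fun t => ?_) (by simpa using hη.const_mul (2 - c))
    have h := sq_norm_cumulativePath_succ_le hc0 hc1 p η t
    rw [mul_div_assoc', mul_div_assoc', ← add_div]
    refine div_le_div₀ ((sq_nonneg _).trans h) h (by positivity) (by push_cast; linarith)
  have h2 : Tendsto (fun t : ℕ => (1 - c) * (‖cumulativePath c p η t‖ ^ 2 / (t + 1 : ℝ)) +
      (2 - c) * (‖η t‖ ^ 2 / (t + 1 : ℝ))) atTop (𝓝 0) := by
    simpa using (key.const_mul (1 - c)).add (hη.const_mul (2 - c))
  refine squeeze_zero (fun t => by positivity) (fun t => ?_) h2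
  rw [mul_div_assoc', mul_div_assoc', ← add_div]
  push_cast
  gcongr
  exact sq_norm_cumulativePath_succ_le hc0 hc1 p η t

theorem _root_.MeasureTheory.MemLp.integrable_sq_norm {Ω : Type*} [MeasurableSpace Ω]
    {P : Measure Ω} {X : Ω → E} (hX : MemLp X 2 P) : Integrable (fun ω => ‖X ω‖ ^ 2) P :=
  hX.norm.integrable_sq

end Path

/-! ### Limit of the averaged squared path norm for i.i.d. steps -/

section Noise

variable {Ω E : Type*} [mΩ : MeasurableSpace Ω] [NormedAddCommGroup E] [InnerProductSpace ℝ E]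
  [CompleteSpace E] [SecondCountableTopology E] [mE : MeasurableSpace E] [BorelSpace E]

/-- Square integrable, identically distributed steps `η t`, each independent of the past `ℱ t`,
and a square integrable initial path. -/
structure IsStepProcess (P : Measure Ω) (ℱ : Filtration ℕ mΩ) (p : Ω → E) (η : ℕ → Ω → E) :
    Prop where
  measurable_init : Measurable[ℱ 0] p
  measurable_step : ∀ t, Measurable[ℱ (t + 1)] (η t)
  indep : ∀ t, Indep (ℱ t) (mE.comap (η t)) P
  identDistrib : ∀ t, IdentDistrib (η t) (η 0) P P
  memLp_init : MemLp p 2 P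
  memLp_step : MemLp (η 0) 2 P

namespace IsStepProcess

variable {P : Measure Ω} {ℱ : Filtration ℕ mΩ} {p : Ω → E} {η : ℕ → Ω → E}

theorem indepFun (h : IsStepProcess P ℱ p η) {β : Type*} [mβ : MeasurableSpace β] {t : ℕ}
    {Y : Ω → β} (hY : Measurable[ℱ t] Y) : IndepFun Y (η t) P := by
  rw [IndepFun_iff_Indep]
  exact indep_of_indep_of_le_left (h.indep t) hY.comap_le

theorem pairwise_indepFun (h : IsStepProcess P ℱ p η) :
    Pairwise (Function.onFun (fun X Y => IndepFun X Y P) η) := by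
  have hlt : ∀ s t, s < t → IndepFun (η s) (η t) P := fun s t hst =>
    h.indepFun ((h.measurable_step s).mono (ℱ.mono hst) le_rfl)
  intro s t hst
  rcases hst.lt_or_gt with h1 | h1
  · exact hlt s t h1
  · exact (hlt t s h1).symm

theorem memLp (h : IsStepProcess P ℱ p η) (t : ℕ) : MemLp (η t) 2 P :=
  (h.identDistrib t).memLp_iff.2 h.memLp_step

theorem integral_eq (h : IsStepProcess P ℱ p η) (t : ℕ) : ∫ ω, η t ω ∂P = ∫ ω, η 0 ω ∂P :=
  (h.identDistrib t).integral_eq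

theorem integral_sq_norm_eq (h : IsStepProcess P ℱ p η) (t : ℕ) :
    ∫ ω, ‖η t ω‖ ^ 2 ∂P = ∫ ω, ‖η 0 ω‖ ^ 2 ∂P :=
  ((h.identDistrib t).comp (u := fun x : E => ‖x‖ ^ 2) (by fun_prop)).integral_eq

variable {c : ℝ}

theorem measurable_path (h : IsStepProcess P ℱ p η) (c : ℝ) (t : ℕ) :
    Measurable[ℱ t] fun ω => cumulativePath c (p ω) (fun s => η s ω) t := by
  induction t with
  | zero => exact h.measurable_init
  | succ t ih =>
    have h1 := ih.mono (ℱ.mono (Nat.le_succ t)) le_rfl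
    have h2 := h.measurable_step t
    exact (h1.const_smul (1 - c)).add (h2.const_smul _)

theorem memLp_path (h : IsStepProcess P ℱ p η) (c : ℝ) (t : ℕ) :
    MemLp (fun ω => cumulativePath c (p ω) (fun s => η s ω) t) 2 P := by
  induction t with
  | zero => exact h.memLp_init
  | succ t ih => exact (ih.const_smul (1 - c)).add ((h.memLp t).const_smul _)

/-- The second moments contract by `1 - c` up to the additive constant `(2 - c) M`, so any `K` above
the initial value with `(2 - c) M ≤ c K` is preserved. -/
theorem exists_integral_sq_norm_path_le (h : IsStepProcess P ℱ p η) (hc0 : 0 < c) (hc1 : c ≤ 1) :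
    ∃ K, ∀ t, ∫ ω, ‖cumulativePath c (p ω) (fun s => η s ω) t‖ ^ 2 ∂P ≤ K := by
  set M := ∫ ω, ‖η 0 ω‖ ^ 2 ∂P
  refine ⟨max (∫ ω, ‖p ω‖ ^ 2 ∂P) ((2 - c) * M / c), fun t => ?_⟩
  set K := max (∫ ω, ‖p ω‖ ^ 2 ∂P) ((2 - c) * M / c)
  induction t with
  | zero => exact le_max_left _ _
  | succ t ih =>
    have hK : (2 - c) * M ≤ c * K := by
      have := le_max_right (∫ ω, ‖p ω‖ ^ 2 ∂P) ((2 - c) * M / c)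
      rwa [div_le_iff₀' hc0] at this
    have hi1 := (h.memLp_path c t).integrable_sq_norm.const_mul (1 - c)
    have hi2 := (h.memLp t).integrable_sq_norm.const_mul (2 - c)
    have h1 := integral_mono (h.memLp_path c (t + 1)).integrable_sq_norm (hi1.add hi2)
      fun ω => sq_norm_cumulativePath_succ_le hc0 hc1 (p ω) (fun s => η s ω) t
    simp only [Pi.add_apply] at h1
    rw [integral_add hi1 hi2, integral_const_mul, integral_const_mul, h.integral_sq_norm_eq] at h1
    nlinarith [mul_le_mul_of_nonneg_left ih (sub_nonneg.2 hc1)]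

variable [IsProbabilityMeasure P]

/-- The increments `⟪p t, η t - E η⟫`. -/
def increment (P : Measure Ω) (c : ℝ) (p : Ω → E) (η : ℕ → Ω → E) (t : ℕ) (ω : Ω) : ℝ :=
  inner ℝ (cumulativePath c (p ω) (fun s => η s ω) t) (η t ω - ∫ ω, η 0 ω ∂P)

theorem measurable_increment (h : IsStepProcess P ℱ p η) (c : ℝ) (t : ℕ) :
    Measurable[ℱ (t + 1)] (increment P c p η t) := by
  have h1 := (h.measurable_path c t).mono (ℱ.mono (Nat.le_succ t)) le_rfl
  have h2 := (h.measurable_step t).sub_const (∫ ω, η 0 ω ∂P)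
  exact h1.inner h2

theorem memLp_centered (h : IsStepProcess P ℱ p η) (t : ℕ) :
    MemLp (fun ω => η t ω - ∫ ω, η 0 ω ∂P) 2 P := (h.memLp t).sub (memLp_const _)

theorem indepFun_sq_norm (h : IsStepProcess P ℱ p η) (c : ℝ) (t : ℕ) :
    IndepFun (fun ω => ‖cumulativePath c (p ω) (fun s => η s ω) t‖ ^ 2)
      (fun ω => ‖η t ω - ∫ ω, η 0 ω ∂P‖ ^ 2) P :=
  (h.indepFun (h.measurable_path c t)).comp (φ := fun x : E => ‖x‖ ^ 2)
    (ψ := fun x : E => ‖x - ∫ ω, η 0 ω ∂P‖ ^ 2) (by fun_prop) (by fun_prop)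

/-- Cauchy–Schwarz dominates the squared increment by a product of two independent integrable
factors, so no fourth moments are needed. -/
theorem memLp_increment (h : IsStepProcess P ℱ p η) (c : ℝ) (t : ℕ) :
    MemLp (increment P c p η t) 2 P := by
  have hm : AEStronglyMeasurable (increment P c p η t) P :=
    ((h.measurable_increment c t).mono (ℱ.le _) le_rfl).aestronglyMeasurable
  rw [memLp_two_iff_integrable_sq hm]
  refine ((h.indepFun_sq_norm c t).integrable_mul (h.memLp_path c t).integrable_sq_norm
    (h.memLp_centered t).integrable_sq_norm).mono' (hm.pow 2) (ae_of_all _ fun ω => ?_)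
  rw [Real.norm_of_nonneg (sq_nonneg _)]
  exact sq_inner_le _ _

theorem exists_integral_sq_increment_le (h : IsStepProcess P ℱ p η) (hc0 : 0 < c) (hc1 : c ≤ 1) :
    ∃ C, ∀ t, ∫ ω, increment P c p η t ω ^ 2 ∂P ≤ C := by
  obtain ⟨K, hK⟩ := h.exists_integral_sq_norm_path_le hc0 hc1
  have hV : ∀ t, ∫ ω, ‖η t ω - ∫ ω, η 0 ω ∂P‖ ^ 2 ∂P = ∫ ω, ‖η 0 ω - ∫ ω, η 0 ω ∂P‖ ^ 2 ∂P :=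
    fun t => ((h.identDistrib t).comp (u := fun x : E => ‖x - ∫ ω, η 0 ω ∂P‖ ^ 2)
      (by fun_prop)).integral_eq
  refine ⟨K * ∫ ω, ‖η 0 ω - ∫ ω, η 0 ω ∂P‖ ^ 2 ∂P, fun t => ?_⟩
  have hi := (h.indepFun_sq_norm c t).integrable_mul (h.memLp_path c t).integrable_sq_norm
    (h.memLp_centered t).integrable_sq_norm
  calc _ ≤ ∫ ω, ‖cumulativePath c (p ω) (fun s => η s ω) t‖ ^ 2 *
        ‖η t ω - ∫ ω, η 0 ω ∂P‖ ^ 2 ∂P :=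
      integral_mono (h.memLp_increment c t).integrable_sq hi fun ω => sq_inner_le _ _
    _ = _ := (h.indepFun_sq_norm c t).integral_fun_mul_eq_mul_integral
      (h.memLp_path c t).integrable_sq_norm.aestronglyMeasurable
      (h.memLp_centered t).integrable_sq_norm.aestronglyMeasurable
    _ ≤ _ := by
      rw [hV]
      exact mul_le_mul_of_nonneg_right (hK t) (integral_nonneg fun ω => sq_nonneg _)

/-- The martingale-difference property: by independence the expectation of the bilinear form
factors, and the centered step has mean zero. -/
theorem integral_inner_centered (h : IsStepProcess P ℱ p η) {t : ℕ} {Y : Ω → E}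
    (hY : Measurable[ℱ t] Y) (hYi : Integrable Y P) :
    ∫ ω, inner ℝ (Y ω) (η t ω - ∫ ω, η 0 ω ∂P) ∂P = 0 := by
  have hind : IndepFun Y (fun ω => η t ω - ∫ ω, η 0 ω ∂P) P :=
    (h.indepFun hY).comp (φ := id) (ψ := fun x : E => x - ∫ ω, η 0 ω ∂P) measurable_id
      (by fun_prop)
  have hint := (h.memLp t).integrable one_le_two
  have h1 : ∫ ω, inner ℝ (Y ω) (η t ω - ∫ ω, η 0 ω ∂P) ∂P =
      inner ℝ (∫ ω, Y ω ∂P) (∫ ω, (η t ω - ∫ ω, η 0 ω ∂P) ∂P) :=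
    hind.integral_bilin hYi (hint.sub (integrable_const _)) (innerSL ℝ)
  rw [h1, integral_sub hint (integrable_const _), h.integral_eq]
  simp

theorem integral_increment (h : IsStepProcess P ℱ p η) (c : ℝ) (t : ℕ) :
    ∫ ω, increment P c p η t ω ∂P = 0 :=
  h.integral_inner_centered (h.measurable_path c t) ((h.memLp_path c t).integrable one_le_two)

/-- Each increment is orthogonal to the preceding partial sum and has bounded variance, so the
partial sums have mean square at most `C T`. -/
theorem ae_tendsto_average_increment (h : IsStepProcess P ℱ p η) (hc0 : 0 < c) (hc1 : c ≤ 1) :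
    ∀ᵐ ω ∂P, Tendsto (fun T : ℕ => (∑ t ∈ Finset.range T, increment P c p η t ω) / T)
      atTop (𝓝 0) := by
  obtain ⟨C, hC⟩ := h.exists_integral_sq_increment_le hc0 hc1
  refine ae_tendsto_average_zero (h.memLp_increment c) hC fun T => ?_
  have hS : ∀ T, MemLp (fun ω => ∑ t ∈ Finset.range T, increment P c p η t ω) 2 P := fun T =>
    memLp_finsetSum _ fun t _ => h.memLp_increment c t
  have hSm : ∀ T, Measurable[ℱ T] fun ω => ∑ t ∈ Finset.range T, increment P c p η t ω := by
    intro T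
    refine Finset.measurable_fun_sum _ fun t ht => ?_
    exact (h.measurable_increment c t).mono (ℱ.mono (Finset.mem_range.1 ht)) le_rfl
  induction T with
  | zero => simp
  | succ T ih =>
    -- The partial sum is absorbed as a scalar into the path; the product is still measurable with
    -- respect to the past and integrable, being a product of two `L²` factors.
    have hcross : ∫ ω, (∑ t ∈ Finset.range T, increment P c p η t ω) *
        increment P c p η T ω ∂P = 0 := by
      have := h.integral_inner_centered (t := T)
        (Y := fun ω => (∑ t ∈ Finset.range T, increment P c p η t ω) •
          cumulativePath c (p ω) (fun s => η s ω) T)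
        ((hSm T).smul (h.measurable_path c T))
        (memLp_one_iff_integrable.1 ((h.memLp_path c T).smul (hS T)))
      simp only [inner_smul_left, RCLike.conj_to_real] at this
      exact this
    have hi1 := (hS T).integrable_sq
    have hi2 : Integrable (fun ω => 2 * ((∑ t ∈ Finset.range T, increment P c p η t ω) *
        increment P c p η T ω)) P :=
      ((hS T).integrable_mul (h.memLp_increment c T)).const_mul 2
    have hi3 := (h.memLp_increment c T).integrable_sq
    have hexp : ∀ ω, (∑ t ∈ Finset.range (T + 1), increment P c p η t ω) ^ 2 =
        (∑ t ∈ Finset.range T, increment P c p η t ω) ^ 2 +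
        2 * ((∑ t ∈ Finset.range T, increment P c p η t ω) * increment P c p η T ω) +
        increment P c p η T ω ^ 2 := fun ω => by
      rw [Finset.sum_range_succ]
      ring
    simp_rw [hexp]
    rw [integral_add (by exact hi1.add hi2) hi3, integral_add hi1 hi2, integral_const_mul, hcross]
    push_cast
    linarith [hC T]

/-- The limit of the averages of `‖p t‖²`. -/
def limitSqNorm (P : Measure Ω) (c : ℝ) (η : ℕ → Ω → E) : ℝ :=
  2 * (1 - c) / c * ‖∫ ω, η 0 ω ∂P‖ ^ 2 + ∫ ω, ‖η 0 ω‖ ^ 2 ∂P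

/-- The pathwise form of the averages, solved for the sum. -/
theorem average_sq_norm_path (hc0 : 0 < c) (hc1 : c ≤ 1) (ω : Ω) (T : ℕ) :
    (∑ t ∈ Finset.range T, ‖cumulativePath c (p ω) (fun s => η s ω) (t + 1)‖ ^ 2) / (T : ℝ) =
      (c * (2 - c))⁻¹ * ((1 - c) ^ 2 *
        (‖p ω‖ ^ 2 / T - ‖cumulativePath c (p ω) (fun s => η s ω) T‖ ^ 2 / T) +
      2 * (1 - c) * Real.sqrt (c * (2 - c)) *
        ((∑ t ∈ Finset.range T, increment P c p η t ω) / T) +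
      2 * (1 - c) * Real.sqrt (c * (2 - c)) / c *
        (inner ℝ (∫ ω, η 0 ω ∂P) (p ω) / T -
          inner ℝ (∫ ω, η 0 ω ∂P) (cumulativePath c (p ω) (fun s => η s ω) T) / T)) +
      (2 * (1 - c) / c * inner ℝ (∫ ω, η 0 ω ∂P) ((T : ℝ)⁻¹ • ∑ t ∈ Finset.range T, η t ω) +
        (∑ t ∈ Finset.range T, ‖η t ω‖ ^ 2) / T) := by
  have h := sum_sq_norm_cumulativePath hc0 hc1 (p ω) (∫ ω, η 0 ω ∂P) (fun s => η s ω) T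
  have hpos : 0 < c * (2 - c) := mul_pos hc0 (by linarith)
  rw [← eq_inv_mul_iff_mul_eq₀ hpos.ne'] at h
  rw [h, inner_smul_right]
  unfold increment
  have hc : (c * (2 - c))⁻¹ * (c * (2 - c)) = 1 := inv_mul_cancel₀ hpos.ne'
  simp only [div_eq_mul_inv]
  linear_combination (2 * (1 - c) * c⁻¹ * ((T : ℝ)⁻¹ *
    inner ℝ (∫ ω, η 0 ω ∂P) (∑ t ∈ Finset.range T, η t ω)) +
    (∑ t ∈ Finset.range T, ‖η t ω‖ ^ 2) * (T : ℝ)⁻¹) * hc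

/-- In the exact identity the boundary terms and the increments vanish after division by `T`; what
remains is governed by the strong laws for `η` and `‖η‖²`. -/
theorem ae_tendsto_average_sq_norm_path (h : IsStepProcess P ℱ p η) (hc0 : 0 < c) (hc1 : c ≤ 1) :
    ∀ᵐ ω ∂P, Tendsto (fun T : ℕ =>
      (∑ t ∈ Finset.range T, ‖cumulativePath c (p ω) (fun s => η s ω) (t + 1)‖ ^ 2) / (T : ℝ))
      atTop (𝓝 (limitSqNorm P c η)) := by
  have hmean := strong_law_ae η (h.memLp_step.integrable one_le_two) h.pairwise_indepFun
    h.identDistrib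
  have hsq := strong_law_ae_real (fun t ω => ‖η t ω‖ ^ 2) h.memLp_step.integrable_sq_norm
    (fun s t hst => (h.pairwise_indepFun hst).comp (φ := fun x : E => ‖x‖ ^ 2)
      (ψ := fun x : E => ‖x‖ ^ 2) (by fun_prop) (by fun_prop))
    (fun t => (h.identDistrib t).comp (u := fun x : E => ‖x‖ ^ 2) (by fun_prop))
  filter_upwards [hmean, hsq, h.ae_tendsto_average_increment hc0 hc1] with ω h1 h2 h3
  simp_rw [average_sq_norm_path (P := P) hc0 hc1]
  -- If `A t` is the average of the first `t` squared norms, the quotient is `A (t + 1) - A t * (t /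
  -- (t + 1))`, a difference of sequences with the same limit.
  have hstep : Tendsto (fun t : ℕ => ‖η t ω‖ ^ 2 / (t + 1 : ℝ)) atTop (𝓝 0) := by
    have hratio : Tendsto (fun t : ℕ => (t : ℝ) / (t + 1)) atTop (𝓝 1) :=
      tendsto_natCast_div_add_atTop 1
    have hdiff := ((tendsto_add_atTop_iff_nat 1).2 h2).sub (h2.mul hratio)
    rw [mul_one, sub_self] at hdiff
    refine hdiff.congr fun t => ?_
    rcases Nat.eq_zero_or_pos t with rfl | ht
    · simp
    have ht' : (0 : ℝ) < t := by exact_mod_cast ht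
    rw [Finset.sum_range_succ]
    push_cast
    field_simp
    ring
  have hpath := tendsto_sq_norm_cumulativePath_div hc0 hc1 (p ω) (fun s => η s ω) hstep
  have hconst : ∀ a : ℝ, Tendsto (fun T : ℕ => a / (T : ℝ)) atTop (𝓝 0) := fun a =>
    tendsto_const_div_atTop_nhds_zero_nat a
  have hlin : Tendsto (fun T : ℕ => inner ℝ (∫ ω, η 0 ω ∂P)
      (cumulativePath c (p ω) (fun s => η s ω) T) / (T : ℝ)) atTop (𝓝 0) := by
    refine squeeze_zero_norm (fun T => ?_)
      (by simpa using (hconst (‖∫ ω, η 0 ω ∂P‖ ^ 2)).add hpath)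
    rw [← add_div, norm_div, Real.norm_eq_abs, Real.norm_of_nonneg (Nat.cast_nonneg T)]
    gcongr
    exact abs_inner_le _ _
  have hη : Tendsto (fun T : ℕ => inner ℝ (∫ ω, η 0 ω ∂P)
      ((T : ℝ)⁻¹ • ∑ t ∈ Finset.range T, η t ω)) atTop (𝓝 (‖∫ ω, η 0 ω ∂P‖ ^ 2)) := by
    have := (tendsto_const_nhds (x := ∫ ω, η 0 ω ∂P)).inner (𝕜 := ℝ) h1
    rwa [real_inner_self_eq_norm_sq] at this
  have hall := (((((hconst (‖p ω‖ ^ 2)).sub hpath).const_mul ((1 - c) ^ 2)).add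
    (h3.const_mul (2 * (1 - c) * Real.sqrt (c * (2 - c))))).add
    (((hconst (inner ℝ (∫ ω, η 0 ω ∂P) (p ω))).sub hlin).const_mul
      (2 * (1 - c) * Real.sqrt (c * (2 - c)) / c))).const_mul (c * (2 - c))⁻¹ |>.add
    ((hη.const_mul (2 * (1 - c) / c)).add h2)
  simpa [limitSqNorm] using hall

/-- No uniform integrability argument is needed: integrating the exact identity term by term, the
increments contribute zero, the step averages give the limit exactly for `T ≥ 1`, and the boundary
terms are `O(1 / T)` by the uniform second-moment bound. -/
theorem tendsto_integral_average_sq_norm_path (h : IsStepProcess P ℱ p η) (hc0 : 0 < c)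
    (hc1 : c ≤ 1) :
    Tendsto (fun T : ℕ => ∫ ω,
      (∑ t ∈ Finset.range T, ‖cumulativePath c (p ω) (fun s => η s ω) (t + 1)‖ ^ 2) / (T : ℝ) ∂P)
      atTop (𝓝 (limitSqNorm P c η)) := by
  set m := ∫ ω, η 0 ω ∂P with hm
  have hint : ∀ t, Integrable (η t) P := fun t => (h.memLp t).integrable one_le_two
  have hpint : ∀ t, Integrable (fun ω => cumulativePath c (p ω) (fun s => η s ω) t) P :=
    fun t => (h.memLp_path c t).integrable one_le_two
  have hp0 : Integrable p P := h.memLp_init.integrable one_le_two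
  obtain ⟨K, hK⟩ := h.exists_integral_sq_norm_path_le hc0 hc1
  have hconst : ∀ a : ℝ, Tendsto (fun T : ℕ => a / (T : ℝ)) atTop (𝓝 0) := fun a =>
    tendsto_const_div_atTop_nhds_zero_nat a
  have hpath : Tendsto (fun T : ℕ =>
      (∫ ω, ‖cumulativePath c (p ω) (fun s => η s ω) T‖ ^ 2 ∂P) / (T : ℝ)) atTop (𝓝 0) := by
    refine squeeze_zero (fun T => div_nonneg (integral_nonneg fun ω => sq_nonneg _)
      (Nat.cast_nonneg T)) (fun T => ?_) (hconst K)
    gcongr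
    exact hK T
  have hlin : Tendsto (fun T : ℕ => (∫ ω, inner ℝ m
      (cumulativePath c (p ω) (fun s => η s ω) T) ∂P) / (T : ℝ)) atTop (𝓝 0) := by
    refine squeeze_zero_norm (fun T => ?_) (hconst (‖m‖ ^ 2 + K))
    rw [norm_div, Real.norm_of_nonneg (Nat.cast_nonneg T)]
    gcongr
    refine (norm_integral_le_of_norm_le ((integrable_const (‖m‖ ^ 2)).add
      (h.memLp_path c T).integrable_sq_norm) (ae_of_all _ fun ω => abs_inner_le _ _)).trans ?_
    simp only [Pi.add_apply]
    rw [integral_add (integrable_const _) (h.memLp_path c T).integrable_sq_norm]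
    simpa using hK T
  have hall := ((((hconst (∫ ω, ‖p ω‖ ^ 2 ∂P)).sub hpath).const_mul ((1 - c) ^ 2)).add
    (((hconst (∫ ω, inner ℝ m (p ω) ∂P)).sub hlin).const_mul
      (2 * (1 - c) * Real.sqrt (c * (2 - c)) / c))).const_mul (c * (2 - c))⁻¹ |>.add_const
    (limitSqNorm P c η)
  simp only [sub_zero, mul_zero, add_zero, zero_add] at hall
  refine hall.congr' ?_
  filter_upwards [eventually_ge_atTop 1] with T hT
  have hT' : (T : ℝ) ≠ 0 := by
    have : T ≠ 0 := by omega
    exact_mod_cast this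
  simp_rw [average_sq_norm_path (P := P) hc0 hc1, ← hm]
  have i1 := h.memLp_init.integrable_sq_norm.div_const (T : ℝ)
  have i2 := (h.memLp_path c T).integrable_sq_norm.div_const (T : ℝ)
  have iinc : ∀ t, Integrable (increment P c p η t) P := fun t =>
    (h.memLp_increment c t).integrable one_le_two
  have i3 := (integrable_finsetSum (Finset.range T) fun t _ => iinc t).div_const (T : ℝ)
  have i4 : Integrable (fun ω => inner ℝ m (p ω) / (T : ℝ)) P := (hp0.const_inner m).div_const _
  have i5 := ((hpint T).const_inner (𝕜 := ℝ) m).div_const (T : ℝ)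
  have isum := integrable_finsetSum (Finset.range T) fun t _ => hint t
  have i6 : Integrable (fun ω => inner ℝ m ((T : ℝ)⁻¹ • ∑ t ∈ Finset.range T, η t ω)) P :=
    (isum.smul (T : ℝ)⁻¹).const_inner m
  have i7 := (integrable_finsetSum (Finset.range T)
    fun t _ => (h.memLp t).integrable_sq_norm).div_const (T : ℝ)
  have e3 : ∫ ω, (∑ t ∈ Finset.range T, increment P c p η t ω) / (T : ℝ) ∂P = 0 := by
    rw [integral_div, integral_finsetSum _ fun t _ => iinc t]
    simp [h.integral_increment]
  have e6 : ∫ ω, inner ℝ m ((T : ℝ)⁻¹ • ∑ t ∈ Finset.range T, η t ω) ∂P = ‖m‖ ^ 2 := by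
    rw [integral_inner (f := fun ω => (T : ℝ)⁻¹ • ∑ t ∈ Finset.range T, η t ω)
      (isum.smul (T : ℝ)⁻¹), integral_smul,
      integral_finsetSum _ fun t _ => hint t]
    simp_rw [h.integral_eq, ← hm]
    rw [Finset.sum_const, Finset.card_range, ← Nat.cast_smul_eq_nsmul ℝ, smul_smul,
      inv_mul_cancel₀ hT', one_smul, real_inner_self_eq_norm_sq]
  have e7 : ∫ ω, (∑ t ∈ Finset.range T, ‖η t ω‖ ^ 2) / (T : ℝ) ∂P = ∫ ω, ‖η 0 ω‖ ^ 2 ∂P := by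
    rw [integral_div, integral_finsetSum _ fun t _ => (h.memLp t).integrable_sq_norm]
    simp_rw [h.integral_sq_norm_eq]
    rw [Finset.sum_const, Finset.card_range, nsmul_eq_mul, mul_div_assoc, mul_comm,
      div_mul_cancel₀ _ hT']
  have j1 := (i1.sub i2).const_mul ((1 - c) ^ 2)
  have j2 := i3.const_mul (2 * (1 - c) * Real.sqrt (c * (2 - c)))
  have j3 := (i4.sub i5).const_mul (2 * (1 - c) * Real.sqrt (c * (2 - c)) / c)
  have j4 := i6.const_mul (2 * (1 - c) / c)
  simp only [Pi.sub_apply] at j1 j3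
  rw [integral_add (by exact ((j1.add j2).add j3).const_mul _) (by exact j4.add i7),
    integral_const_mul, integral_add (by exact j1.add j2) j3, integral_add j1 j2,
    integral_add j4 i7, integral_const_mul, integral_const_mul, integral_const_mul,
    integral_const_mul, integral_sub i1 i2, integral_sub i4 i5, e3, e6, e7, limitSqNorm,
    integral_div, integral_div, integral_div, integral_div]
  ring

theorem integrable_average_sq_norm_path (h : IsStepProcess P ℱ p η) (c : ℝ) (T : ℕ) :
    Integrable (fun ω =>
      (∑ t ∈ Finset.range T, ‖cumulativePath c (p ω) (fun s => η s ω) (t + 1)‖ ^ 2) / (T : ℝ)) P :=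
  (integrable_finsetSum _ fun t _ => (h.memLp_path c (t + 1)).integrable_sq_norm).div_const _

end IsStepProcess

end Noise

/-! ### Moments of the smallest of several standard normals -/

section OrderStatistics

instance isOpenPosMeasure_gaussianReal : (gaussianReal 0 1).IsOpenPosMeasure :=
  (gaussianReal_absolutelyContinuous' 0 one_ne_zero).isOpenPosMeasure

theorem integral_sq_gaussianReal : ∫ x, x ^ 2 ∂gaussianReal 0 1 = 1 := by
  have h := variance_id_gaussianReal (μ := 0) (v := 1)
  rw [variance_of_integral_eq_zero aemeasurable_id (by simp)] at h
  simpa using h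

variable {lam : ℕ}

theorem measurable_iInf_fin : Measurable fun v : Fin lam → ℝ => ⨅ i, v i :=
  Measurable.iInf fun i => measurable_pi_apply i

theorem abs_iInf_le_sum (v : Fin lam → ℝ) : |⨅ i, v i| ≤ ∑ i, |v i| := by
  rcases isEmpty_or_nonempty (Fin lam) with h | h
  · simp
  · obtain ⟨i, hi⟩ := exists_eq_ciInf_of_finite (f := v)
    rw [← hi]
    exact Finset.single_le_sum (f := fun i => |v i|) (fun j _ => abs_nonneg _) (Finset.mem_univ i)

theorem memLp_eval_pi_gaussianReal (i : Fin lam) :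
    MemLp (fun v : Fin lam → ℝ => v i) 2 (Measure.pi fun _ : Fin lam => gaussianReal 0 1) :=
  (memLp_id_gaussianReal' 2 (by simp)).comp_measurePreserving
    (measurePreserving_eval (fun _ : Fin lam => gaussianReal 0 1) i)

theorem memLp_iInf_pi_gaussianReal :
    MemLp (fun v : Fin lam → ℝ => ⨅ i, v i) 2
      (Measure.pi fun _ : Fin lam => gaussianReal 0 1) := by
  refine (memLp_finsetSum Finset.univ fun i _ => (memLp_eval_pi_gaussianReal i).abs).mono
    measurable_iInf_fin.aestronglyMeasurable (ae_of_all _ fun v => ?_)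
  rw [Real.norm_eq_abs]
  exact (abs_iInf_le_sum v).trans (le_abs_self _)

theorem integral_minNormalLaw :
    ∫ x, x ∂minNormalLaw lam =
      ∫ v, ⨅ i, v i ∂(Measure.pi fun _ : Fin lam => gaussianReal 0 1) :=
  integral_map measurable_iInf_fin.aemeasurable aestronglyMeasurable_id

theorem integral_sq_minNormalLaw :
    ∫ x, x ^ 2 ∂minNormalLaw lam =
      ∫ v, (⨅ i, v i) ^ 2 ∂(Measure.pi fun _ : Fin lam => gaussianReal 0 1) :=
  integral_map measurable_iInf_fin.aemeasurable (by fun_prop)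

/-- The expectation of the smallest of at least two standard normal variables is negative. -/
theorem integral_minNormalLaw_neg (hlam : 2 ≤ lam) : ∫ x, x ∂minNormalLaw lam < 0 := by
  rw [integral_minNormalLaw]
  set μ := Measure.pi fun _ : Fin lam => gaussianReal 0 1
  let i₀ : Fin lam := ⟨0, by omega⟩
  let i₁ : Fin lam := ⟨1, by omega⟩
  have h01 : i₁ ≠ i₀ := by simp [i₀, i₁]
  have hi := (memLp_iInf_pi_gaussianReal (lam := lam)).integrable one_le_two
  have hi0 := (memLp_eval_pi_gaussianReal i₀).integrable one_le_two
  have hbdd : ∀ v : Fin lam → ℝ, BddBelow (Set.range v) := fun v => (Set.finite_range v).bddBelow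
  -- The integrand is nonnegative and is positive on the nonempty open set where `v i₁ < v i₀`,
  -- which a Gaussian product measure charges. Since `v i₀` has mean zero, this gives the sign.
  have hpos : 0 < ∫ v, (v i₀ - ⨅ i, v i) ∂μ := by
    rw [integral_pos_iff_support_of_nonneg (fun v => sub_nonneg.2 (ciInf_le (hbdd v) i₀))
      (hi0.sub hi)]
    have hopen : IsOpen {v : Fin lam → ℝ | v i₁ < v i₀} :=
      isOpen_lt (continuous_apply i₁) (continuous_apply i₀)
    refine (hopen.measure_pos μ ⟨Pi.single i₀ 1, ?_⟩).trans_le (measure_mono fun v hv => ?_)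
    · simp [h01]
    · exact (sub_pos.2 ((ciInf_le (hbdd v) i₁).trans_lt hv)).ne'
  rw [integral_sub hi0 hi] at hpos
  have h0 : ∫ v, v i₀ ∂μ = 0 := by
    rw [integral_eval]
    exact integral_id_gaussianReal
  linarith

/-- Either the minimum lies above `√t`, so every coordinate does, or it lies below `-√t`, so not
every coordinate is at least `-√t`. A box and the complement of a box have probabilities given by
powers. -/
theorem setOf_lt_iInf_sq (hlam : 1 ≤ lam) {t : ℝ} (ht : 0 ≤ t) :
    {v : Fin lam → ℝ | t < (⨅ i, v i) ^ 2} =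
      (Set.univ.pi fun _ => Set.Ioi (Real.sqrt t)) ∪
        (Set.univ.pi fun _ => Set.Ici (-Real.sqrt t))ᶜ := by
  have : Nonempty (Fin lam) := ⟨⟨0, by omega⟩⟩
  ext v
  have hbdd : BddBelow (Set.range v) := (Set.finite_range v).bddBelow
  obtain ⟨j, hj⟩ := exists_eq_ciInf_of_finite (f := v)
  have h1 : t < (⨅ i, v i) ^ 2 ↔ Real.sqrt t < |⨅ i, v i| := by
    rw [← Real.sqrt_sq_eq_abs, Real.sqrt_lt_sqrt_iff ht]
  simp only [Set.mem_ofPred_eq, h1, lt_abs, Set.mem_union, Set.mem_univ_pi, Set.mem_Ioi,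
    Set.mem_compl_iff, Set.mem_Ici, not_forall, not_le]
  refine or_congr ⟨fun h i => h.trans_le (ciInf_le hbdd i), fun h => hj ▸ h j⟩
    ⟨fun h => ⟨j, ?_⟩, fun ⟨i, hi⟩ => ?_⟩
  · rw [hj]
    linarith
  · linarith [ciInf_le hbdd i]

/-- The normal probabilities of exceeding `s` and of falling below `-s` agree. -/
theorem gaussianReal_real_Ici_neg (s : ℝ) :
    (gaussianReal 0 1).real (Set.Ici (-s)) = 1 - (gaussianReal 0 1).real (Set.Ioi s) := by
  have hsym : (gaussianReal 0 1).real (Set.Iio (-s)) = (gaussianReal 0 1).real (Set.Ioi s) := by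
    have h := gaussianReal_map_neg (μ := 0) (v := 1)
    rw [neg_zero] at h
    conv_lhs => rw [← h]
    rw [map_measureReal_apply measurable_neg measurableSet_Iio]
    congr 1
    ext x
    simp
  rw [← hsym, ← probReal_compl_eq_one_sub measurableSet_Iio, Set.compl_Iio]

theorem gaussianReal_real_Ioi_pos (s : ℝ) : 0 < (gaussianReal 0 1).real (Set.Ioi s) :=
  ENNReal.toReal_pos (isOpen_Ioi.measure_pos _ ⟨s + 1, by simp⟩).ne' (measure_ne_top _ _)

/-- By symmetry the two tails have equal mass, and the interval between them has positive mass. -/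
theorem gaussianReal_real_Ioi_lt_half {s : ℝ} (hs : 0 < s) :
    (gaussianReal 0 1).real (Set.Ioi s) < 1 / 2 := by
  have h1 : (gaussianReal 0 1).real (Set.Ioi s ∪ Set.Ioo (-s) s) =
      (gaussianReal 0 1).real (Set.Ioi s) + (gaussianReal 0 1).real (Set.Ioo (-s) s) :=
    measureReal_union (Set.disjoint_left.2 fun x hx hx' => lt_asymm hx hx'.2) measurableSet_Ioo
  have h2 : (gaussianReal 0 1).real (Set.Ioi s ∪ Set.Ioo (-s) s) ≤
      (gaussianReal 0 1).real (Set.Ici (-s)) := by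
    refine measureReal_mono fun x hx => ?_
    rcases hx with hx | hx
    · exact (show -s ≤ x by linarith [show s < x from hx])
    · exact hx.1.le
  have h3 : 0 < (gaussianReal 0 1).real (Set.Ioo (-s) s) :=
    ENNReal.toReal_pos (isOpen_Ioo.measure_pos _ ⟨0, by simpa using hs⟩).ne' (measure_ne_top _ _)
  rw [gaussianReal_real_Ici_neg] at h2
  linarith

theorem measureReal_lt_iInf_sq (hlam : 1 ≤ lam) {t : ℝ} (ht : 0 ≤ t) :
    (Measure.pi fun _ : Fin lam => gaussianReal 0 1).real {v | t < (⨅ i, v i) ^ 2} =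
      (gaussianReal 0 1).real (Set.Ioi (Real.sqrt t)) ^ lam +
        (1 - (1 - (gaussianReal 0 1).real (Set.Ioi (Real.sqrt t))) ^ lam) := by
  have hm : MeasurableSet (Set.univ.pi fun _ : Fin lam => Set.Ici (-Real.sqrt t)) :=
    MeasurableSet.univ_pi fun _ => measurableSet_Ici
  have hpi : ∀ s : Set ℝ, (Measure.pi fun _ : Fin lam => gaussianReal 0 1).real
      (Set.univ.pi fun _ => s) = (gaussianReal 0 1).real s ^ lam := fun s => by
    simp [measureReal_def, Measure.pi_pi]
  rw [setOf_lt_iInf_sq hlam ht, measureReal_union ?_ hm.compl,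
    probReal_compl_eq_one_sub hm, hpi, hpi, gaussianReal_real_Ici_neg]
  refine Set.disjoint_compl_right_iff_subset.2 (Set.pi_mono fun i _ x hx => ?_)
  exact (show -Real.sqrt t ≤ x by linarith [Real.sqrt_nonneg t, show Real.sqrt t < x from hx])

/-- Equality holds at `k = 2`, and passing from `j + 1` to `j + 2` adds `b (1 - b) ((1 - b) ^ j - b
^ j)`, which is nonnegative for `b ≤ 1 / 2`. Here `b` stands for the one-sided normal tail at `√t`.
-/
theorem two_mul_le_pow_add_one_sub_pow {b : ℝ} (hb0 : 0 ≤ b) (hb : b ≤ 1 / 2) {k : ℕ}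
    (hk : 2 ≤ k) : 2 * b ≤ b ^ k + (1 - (1 - b) ^ k) := by
  induction k, hk using Nat.le_induction with
  | base => nlinarith
  | succ k hk ih =>
    have h1 : b ^ (k - 1) ≤ (1 - b) ^ (k - 1) := pow_le_pow_left₀ hb0 (by linarith) _
    obtain ⟨j, rfl⟩ := Nat.exists_eq_add_of_le' (show 1 ≤ k by omega)
    simp only [Nat.add_sub_cancel] at h1
    have h2 : 0 ≤ b * (1 - b) * ((1 - b) ^ j - b ^ j) :=
      mul_nonneg (mul_nonneg hb0 (by linarith)) (sub_nonneg.2 h1)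
    have h3 : b ^ (j + 1 + 1) + (1 - (1 - b) ^ (j + 1 + 1)) =
        b ^ (j + 1) + (1 - (1 - b) ^ (j + 1)) + b * (1 - b) * ((1 - b) ^ j - b ^ j) := by ring
    linarith

theorem two_mul_lt_pow_add_one_sub_pow {b : ℝ} (hb0 : 0 < b) (hb : b < 1 / 2) {k : ℕ}
    (hk : 3 ≤ k) : 2 * b < b ^ k + (1 - (1 - b) ^ k) := by
  obtain ⟨j, rfl⟩ := Nat.exists_eq_add_of_le' hk
  have h1 : b ^ (j + 1) < (1 - b) ^ (j + 1) := pow_lt_pow_left₀ (by linarith) hb0.le (by omega)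
  have h2 : 0 < b * (1 - b) * ((1 - b) ^ (j + 1) - b ^ (j + 1)) :=
    mul_pos (mul_pos hb0 (by linarith)) (sub_pos.2 h1)
  have h3 : b ^ (j + 3) + (1 - (1 - b) ^ (j + 3)) = b ^ (j + 2) + (1 - (1 - b) ^ (j + 2)) +
      b * (1 - b) * ((1 - b) ^ (j + 1) - b ^ (j + 1)) := by ring
  linarith [two_mul_le_pow_add_one_sub_pow hb0.le hb.le (show 2 ≤ j + 2 by omega)]

/-- The layer-cake formula: second moments for different `lam` can now be compared through their
tails, pointwise in `t`. -/
theorem ofReal_integral_sq_iInf (hlam : 1 ≤ lam) :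
    ENNReal.ofReal (∫ x, x ^ 2 ∂minNormalLaw lam) = ∫⁻ t in Set.Ioi (0 : ℝ),
      ENNReal.ofReal ((gaussianReal 0 1).real (Set.Ioi (Real.sqrt t)) ^ lam +
        (1 - (1 - (gaussianReal 0 1).real (Set.Ioi (Real.sqrt t))) ^ lam)) := by
  have hi := (memLp_iInf_pi_gaussianReal (lam := lam)).integrable_sq
  have hnn : 0 ≤ᵐ[Measure.pi fun _ : Fin lam => gaussianReal 0 1]
      fun v : Fin lam → ℝ => (⨅ i, v i) ^ 2 := ae_of_all _ fun v => sq_nonneg _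
  rw [integral_sq_minNormalLaw, ofReal_integral_eq_lintegral_ofReal hi hnn,
    lintegral_eq_lintegral_meas_lt _ hnn hi.aemeasurable]
  refine setLIntegral_congr_fun measurableSet_Ioi fun t ht => ?_
  rw [← measureReal_lt_iInf_sq hlam (le_of_lt ht), ofReal_measureReal]

theorem integral_sq_minNormalLaw_one : ∫ x, x ^ 2 ∂minNormalLaw 1 = 1 := by
  rw [integral_sq_minNormalLaw]
  have h : ∀ v : Fin 1 → ℝ, (⨅ i, v i) = v 0 := fun v => by simp
  simp_rw [h]
  exact (integral_comp_eval (μ := fun _ : Fin 1 => gaussianReal 0 1) (i := 0)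
    (f := fun x : ℝ => x ^ 2) (by fun_prop)).trans integral_sq_gaussianReal

theorem measurable_tail (k : ℕ) : Measurable fun t : ℝ =>
    ENNReal.ofReal ((gaussianReal 0 1).real (Set.Ioi (Real.sqrt t)) ^ k +
      (1 - (1 - (gaussianReal 0 1).real (Set.Ioi (Real.sqrt t))) ^ k)) := by
  have hanti : Antitone fun t : ℝ => (gaussianReal 0 1).real (Set.Ioi (Real.sqrt t)) :=
    fun s t hst => measureReal_mono (Set.Ioi_subset_Ioi (Real.sqrt_le_sqrt hst))
  have := hanti.measurable
  fun_prop

/-- The second moment of the smallest of at least two standard normal variables is at least one. -/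
theorem one_le_integral_sq_minNormalLaw (hlam : 2 ≤ lam) : 1 ≤ ∫ x, x ^ 2 ∂minNormalLaw lam := by
  have h0 : 0 ≤ ∫ x, x ^ 2 ∂minNormalLaw lam := integral_nonneg fun x => sq_nonneg x
  rw [← integral_sq_minNormalLaw_one, ← ENNReal.ofReal_le_ofReal_iff h0,
    ofReal_integral_sq_iInf le_rfl, ofReal_integral_sq_iInf (one_le_two.trans hlam)]
  refine setLIntegral_mono (measurable_tail lam) fun t ht => ENNReal.ofReal_le_ofReal ?_
  -- For one variable the tail expression `b ^ 1 + (1 - (1 - b) ^ 1)` equals `2 * b`.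
  have := two_mul_le_pow_add_one_sub_pow (gaussianReal_real_Ioi_pos (Real.sqrt t)).le
    (gaussianReal_real_Ioi_lt_half (Real.sqrt_pos.2 ht)).le hlam
  linarith

theorem one_lt_integral_sq_minNormalLaw (hlam : 3 ≤ lam) : 1 < ∫ x, x ^ 2 ∂minNormalLaw lam := by
  have h1 : ENNReal.ofReal (∫ x, x ^ 2 ∂minNormalLaw 1) <
      ENNReal.ofReal (∫ x, x ^ 2 ∂minNormalLaw lam) := by
    have htop : ENNReal.ofReal (∫ x, x ^ 2 ∂minNormalLaw 1) ≠ ⊤ := ENNReal.ofReal_ne_top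
    rw [ofReal_integral_sq_iInf le_rfl] at htop ⊢
    rw [ofReal_integral_sq_iInf (show 1 ≤ lam by omega)]
    refine setLIntegral_strict_mono measurableSet_Ioi (by simp) (measurable_tail lam) htop
      (ae_of_all _ fun t ht => ?_)
    have hlt := two_mul_lt_pow_add_one_sub_pow (gaussianReal_real_Ioi_pos (Real.sqrt t))
      (gaussianReal_real_Ioi_lt_half (Real.sqrt_pos.2 ht)) hlam
    have := gaussianReal_real_Ioi_pos (Real.sqrt t)
    exact (ENNReal.ofReal_lt_ofReal_iff (by linarith)).2 (by linarith)
  rw [integral_sq_minNormalLaw_one] at h1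
  exact ((ENNReal.ofReal_lt_ofReal_iff_of_nonneg zero_le_one).1 h1)

/-- Both summands are nonnegative. The first is positive when `c < 1` because the mean of the
minimum is nonzero, the second when `lam ≥ 3` because the second moment exceeds one. -/
theorem rate_pos {n : ℕ} (hn : 0 < n) {c d : ℝ} (hc0 : 0 < c) (hc1 : c ≤ 1) (hd : 0 < d)
    (hlam : 2 ≤ lam) (h : c < 1 ∨ 3 ≤ lam) : 0 < rate n lam c d := by
  have hn' : (0 : ℝ) < n := by exact_mod_cast hn
  have hm := integral_minNormalLaw_neg hlam
  have hs := one_le_integral_sq_minNormalLaw hlam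
  refine mul_pos (by positivity) ?_
  rcases h with h | h
  · have h1 : 0 < 2 * (1 - c) * (∫ x, x ∂minNormalLaw lam) ^ 2 :=
      mul_pos (by linarith) (by nlinarith)
    have h2 : 0 ≤ c * ((∫ x, x ^ 2 ∂minNormalLaw lam) - 1) := mul_nonneg hc0.le (by linarith)
    linarith
  · have h1 : 0 ≤ 2 * (1 - c) * (∫ x, x ∂minNormalLaw lam) ^ 2 :=
      mul_nonneg (by linarith) (sq_nonneg _)
    have h2 : 0 < c * ((∫ x, x ^ 2 ∂minNormalLaw lam) - 1) :=
      mul_pos hc0 (by linarith [one_lt_integral_sq_minNormalLaw h])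
    linarith

end OrderStatistics

/-! ### The step selected by a linear form -/

section BestStep

variable {E : Type*} [NormedAddCommGroup E] [InnerProductSpace ℝ E] {lam : ℕ}

/-- The step with the lowest inner product with `a`, when there are no ties. -/
def bestStep (a : E) (z : Fin lam → E) : E :=
  ∑ i, if ∀ j, inner ℝ a (z i) ≤ inner ℝ a (z j) then z i else 0

theorem eq_of_isMin {a : E} {z : Fin lam → E}
    (hinj : Function.Injective fun j => (inner ℝ a (z j) : ℝ)) {i k : Fin lam}
    (hi : ∀ j, inner ℝ a (z i) ≤ inner ℝ a (z j))
    (hk : ∀ j, inner ℝ a (z k) ≤ inner ℝ a (z j)) : k = i :=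
  hinj (le_antisymm (hk i) (hi k))

/-- Without ties exactly one index passes the test, so a quantity attached to the selected child is
a sum over all children with indicators. This is the form in which independence can be applied. -/
theorem sum_ite_isMin {a : E} {z : Fin lam → E}
    (hinj : Function.Injective fun j => (inner ℝ a (z j) : ℝ)) {i : Fin lam}
    (hi : ∀ j, inner ℝ a (z i) ≤ inner ℝ a (z j)) {M : Type*} [AddCommMonoid M]
    (φ : Fin lam → M) :
    (∑ k, if ∀ j, inner ℝ a (z k) ≤ inner ℝ a (z j) then φ k else 0) = φ i := by
  rw [Finset.sum_eq_single i]
  · rw [if_pos hi]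
  · intro k _ hki
    rw [if_neg fun hk => hki (eq_of_isMin hinj hi hk)]
  · simp

theorem bestStep_eq {a : E} {z : Fin lam → E}
    (hinj : Function.Injective fun j => (inner ℝ a (z j) : ℝ)) {i : Fin lam}
    (hi : ∀ j, inner ℝ a (z i) ≤ inner ℝ a (z j)) : bestStep a z = z i :=
  sum_ite_isMin hinj hi z

theorem exists_isMin (hlam : 1 ≤ lam) (a : E) (z : Fin lam → E) :
    ∃ i, ∀ j, inner ℝ a (z i) ≤ inner ℝ a (z j) := by
  have : Nonempty (Fin lam) := ⟨⟨0, by omega⟩⟩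
  exact Finite.exists_min fun j => (inner ℝ a (z j) : ℝ)

theorem norm_bestStep_le (a : E) (z : Fin lam → E) : ‖bestStep a z‖ ≤ ∑ i, ‖z i‖ := by
  refine norm_sum_le_of_le _ fun i _ => ?_
  split_ifs
  · exact le_rfl
  · simp

variable [MeasurableSpace E] [BorelSpace E] [SecondCountableTopology E]

theorem measurableSet_isMin (a : E) (i : Fin lam) :
    MeasurableSet {z : Fin lam → E | ∀ j, inner ℝ a (z i) ≤ inner ℝ a (z j)} := by
  rw [Set.ofPred_forall]
  exact MeasurableSet.iInter fun j => measurableSet_le (by fun_prop) (by fun_prop)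

theorem measurable_bestStep (a : E) : Measurable (bestStep a : (Fin lam → E) → E) :=
  Finset.measurable_fun_sum _ fun i _ =>
    Measurable.ite (measurableSet_isMin a i) (measurable_pi_apply i) measurable_const

end BestStep

/-- Two independent random variables are almost surely distinct if one has no atoms. -/
theorem _root_.ProbabilityTheory.IndepFun.ae_ne {Ω : Type*} [MeasurableSpace Ω] {P : Measure Ω}
    [IsProbabilityMeasure P] {X Y : Ω → ℝ} (h : IndepFun X Y P) (hX : Measurable X)
    (hY : Measurable Y) {ν : Measure ℝ} [NullSingletonClass ν] (hν : HasLaw Y ν P) :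
    ∀ᵐ ω ∂P, X ω ≠ Y ω := by
  have hprod := (indepFun_iff_map_prod_eq_prod_map_map hX.aemeasurable hY.aemeasurable).1 h
  have hdiag : MeasurableSet (Set.diagonal ℝ) := measurableSet_diagonal
  have : SFinite ν := by
    rw [← hν.map_eq]
    infer_instance
  -- The joint law is a product, and each section of the diagonal is a singleton, hence null for the
  -- atomless factor.
  have h0 : P.map (fun ω => (X ω, Y ω)) (Set.diagonal ℝ) = 0 := by
    rw [hprod, hν.map_eq, Measure.measure_prod_null hdiag]
    refine ae_of_all _ fun x => ?_
    have : Prod.mk x ⁻¹' Set.diagonal ℝ = {x} := by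
      ext y
      simp [eq_comm]
    simp [this]
  rw [Measure.map_apply (hX.prodMk hY) hdiag] at h0
  exact measure_mono_null (fun ω hω => by simpa using hω) h0

/-! ### Independence of disjoint subfamilies -/

section Independence

variable {Ω ι β : Type*} [mβ : MeasurableSpace β]

theorem measurable_iSup_comap (W : ι → Ω → β) {S : Set ι} {i : ι} (hi : i ∈ S) :
    Measurable[⨆ j ∈ S, mβ.comap (W j)] (W i) :=
  (comap_measurable (W i)).mono (le_iSup₂_of_le i hi le_rfl) le_rfl

/-- Functions of disjoint subfamilies of an independent family are independent. -/
theorem indepFun_of_measurable_iSup [MeasurableSpace Ω] {P : Measure Ω} {W : ι → Ω → β}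
    (hW : iIndepFun W P) (hWm : ∀ i, Measurable (W i)) {S T : Set ι} (hST : Disjoint S T)
    {γ δ : Type*} [MeasurableSpace γ] [MeasurableSpace δ] {Y : Ω → γ} {Y' : Ω → δ}
    (hY : Measurable[⨆ i ∈ S, mβ.comap (W i)] Y) (hY' : Measurable[⨆ i ∈ T, mβ.comap (W i)] Y') :
    IndepFun Y Y' P := by
  rw [IndepFun_iff_Indep]
  exact indep_of_indep_of_le_left (indep_of_indep_of_le_right
    (indep_iSup_of_disjoint (fun i => (hWm i).comap_le) hW hST) hY'.comap_le) hY.comap_le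

end Independence

/-! ### Moments of the selected Gaussian step -/

section Moments

variable {Ω : Type*} [MeasurableSpace Ω] {P : Measure Ω} {n lam : ℕ}

/-- The coordinates of a standard normal vector in an orthonormal basis are independent standard
normal variables. -/
theorem hasLaw_coordinates {X : Ω → EuclideanSpace ℝ (Fin n)}
    (hX : HasLaw X (stdGaussian (EuclideanSpace ℝ (Fin n))) P)
    (b : OrthonormalBasis (Fin n) ℝ (EuclideanSpace ℝ (Fin n))) :
    HasLaw (fun ω k => inner ℝ (b k) (X ω)) (Measure.pi fun _ : Fin n => gaussianReal 0 1) P := by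
  have hmeas : Measurable fun (x : EuclideanSpace ℝ (Fin n)) (k : Fin n) =>
      (inner ℝ (b k) x : ℝ) := measurable_pi_lambda _ fun k => by fun_prop
  refine HasLaw.fun_comp (Y := fun x k => inner ℝ (b k) x) ⟨hmeas.aemeasurable, ?_⟩ hX
  rw [stdGaussian_eq_map_pi_orthonormalBasis b, Measure.map_map hmeas (by fun_prop)]
  convert Measure.map_id
  ext x k
  simp [inner_sum, inner_smul_right, b.inner_eq_ite]

theorem hasLaw_coordinate {X : Ω → EuclideanSpace ℝ (Fin n)}
    (hX : HasLaw X (stdGaussian (EuclideanSpace ℝ (Fin n))) P)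
    (b : OrthonormalBasis (Fin n) ℝ (EuclideanSpace ℝ (Fin n))) (k : Fin n) :
    HasLaw (fun ω => inner ℝ (b k) (X ω)) (gaussianReal 0 1) P :=
  (measurePreserving_eval (fun _ : Fin n => gaussianReal 0 1) k).hasLaw.fun_comp
    (hasLaw_coordinates hX b)

theorem memLp_of_hasLaw_stdGaussian {X : Ω → EuclideanSpace ℝ (Fin n)}
    (hX : HasLaw X (stdGaussian (EuclideanSpace ℝ (Fin n))) P) : MemLp X 2 P := by
  have h : MemLp id 2 (P.map X) := by
    rw [hX.map_eq]
    exact IsGaussian.memLp_two_id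
  exact (memLp_map_measure_iff aestronglyMeasurable_id hX.aemeasurable).1 h

theorem memLp_bestStep {Z : Fin lam → Ω → EuclideanSpace ℝ (Fin n)}
    (a : EuclideanSpace ℝ (Fin n)) (hZm : ∀ i, Measurable (Z i))
    (hZ : ∀ i, HasLaw (Z i) (stdGaussian (EuclideanSpace ℝ (Fin n))) P) :
    MemLp (fun ω => bestStep a fun i => Z i ω) 2 P := by
  refine (memLp_finsetSum Finset.univ fun i _ => (memLp_of_hasLaw_stdGaussian (hZ i)).norm).mono
    ((measurable_bestStep a).comp (measurable_pi_lambda _ hZm)).aestronglyMeasurable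
    (ae_of_all _ fun ω => ?_)
  exact (norm_bestStep_le a _).trans (le_abs_self _)

variable [IsProbabilityMeasure P]

theorem iIndepFun_coordinates {Z : Fin lam → Ω → EuclideanSpace ℝ (Fin n)}
    (hZm : ∀ i, Measurable (Z i))
    (hZ : ∀ i, HasLaw (Z i) (stdGaussian (EuclideanSpace ℝ (Fin n))) P) (hind : iIndepFun Z P)
    (b : OrthonormalBasis (Fin n) ℝ (EuclideanSpace ℝ (Fin n))) :
    iIndepFun (fun (q : Fin lam × Fin n) ω => (inner ℝ (b q.2) (Z q.1 ω) : ℝ)) P := by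
  refine iIndepFun_uncurry' (X := fun i k ω => (inner ℝ (b k) (Z i ω) : ℝ)) (fun i k => ?_) ?_
    fun i => ?_
  · have := hZm i
    fun_prop
  · exact hind.comp (fun _ x k => (inner ℝ (b k) x : ℝ))
      fun i => measurable_pi_lambda _ fun k => by fun_prop
  · exact (iIndepFun_iff_hasLaw_pi_pi fun k => hasLaw_coordinate (hZ i) b k).2
      (hasLaw_coordinates (hZ i) b)

/-- In a basis adapted to `a`, selection looks at a single coordinate. -/
theorem exists_orthonormalBasis_smul {a : EuclideanSpace ℝ (Fin n)} (ha : a ≠ 0) :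
    ∃ (b : OrthonormalBasis (Fin n) ℝ (EuclideanSpace ℝ (Fin n))) (k₀ : Fin n),
      a = ‖a‖ • b k₀ := by
  have hn : 0 < n := by
    rcases Nat.eq_zero_or_pos n with rfl | h
    · exact absurd (Subsingleton.elim a 0) ha
    · exact h
  have ha' : ‖a‖ ≠ 0 := norm_ne_zero_iff.2 ha
  let k₀ : Fin n := ⟨0, hn⟩
  have hon : Orthonormal ℝ (({k₀} : Set (Fin n)).domRestrict fun _ => ‖a‖⁻¹ • a) := by
    refine ⟨fun i => ?_, fun i j hij => absurd (Subsingleton.elim i j) hij⟩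
    rw [Set.domRestrict_apply, norm_smul, norm_inv, norm_norm, inv_mul_cancel₀ ha']
  obtain ⟨b, hb⟩ := hon.exists_orthonormalBasis_extension_of_card_eq (by simp)
  refine ⟨b, k₀, ?_⟩
  rw [hb k₀ rfl, smul_smul, mul_inv_cancel₀ ha', one_smul]

variable {Z : Fin lam → Ω → EuclideanSpace ℝ (Fin n)} {a : EuclideanSpace ℝ (Fin n)}

theorem ae_injective_inner (ha : a ≠ 0) (hZm : ∀ i, Measurable (Z i))
    (hZ : ∀ i, HasLaw (Z i) (stdGaussian (EuclideanSpace ℝ (Fin n))) P) (hind : iIndepFun Z P) :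
    ∀ᵐ ω ∂P, Function.Injective fun j => (inner ℝ a (Z j ω) : ℝ) := by
  obtain ⟨b, k₀, hb⟩ := exists_orthonormalBasis_smul ha
  have hne : ∀ i j, i ≠ j → ∀ᵐ ω ∂P, (inner ℝ (b k₀) (Z i ω) : ℝ) ≠ inner ℝ (b k₀) (Z j ω) := by
    intro i j hij
    have := nullSingletonClass_gaussianReal (μ := 0) (v := 1) one_ne_zero
    have hi := hZm i
    have hj := hZm j
    refine ((hind.indepFun hij).comp (φ := fun x => (inner ℝ (b k₀) x : ℝ))
      (ψ := fun x => (inner ℝ (b k₀) x : ℝ)) (by fun_prop) (by fun_prop)).ae_ne ?_ ?_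
      (hasLaw_coordinate (hZ j) b k₀)
    · fun_prop
    · fun_prop
  have hall : ∀ᵐ ω ∂P, ∀ i j, i ≠ j →
      (inner ℝ (b k₀) (Z i ω) : ℝ) ≠ inner ℝ (b k₀) (Z j ω) := by
    simp only [ae_all_iff]
    exact hne
  filter_upwards [hall] with ω hω i j hij
  by_contra hne'
  refine hω i j hne' ?_
  simp only at hij
  rw [hb, inner_smul_left, inner_smul_left] at hij
  exact mul_left_cancel₀ (by simpa using ha) hij

/-- The indicator of `v i` being the smallest coordinate of `v`. -/
def minIndicator (i : Fin lam) (v : Fin lam → ℝ) : ℝ := if ∀ j, v i ≤ v j then 1 else 0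

theorem measurable_minIndicator (i : Fin lam) : Measurable (minIndicator i) := by
  refine Measurable.ite ?_ measurable_const measurable_const
  rw [Set.ofPred_forall]
  exact MeasurableSet.iInter fun j => measurableSet_le (by fun_prop) (by fun_prop)

theorem norm_minIndicator_le (i : Fin lam) (v : Fin lam → ℝ) : ‖minIndicator i v‖ ≤ 1 := by
  rw [minIndicator]
  split_ifs <;> simp

/-- The left side uses only the scalar variables with basis index `k₀`, the right side one with
index `k`: disjoint parts of the independent family of all coordinates of all children. The left
side determines which child is selected. -/
theorem indepFun_coordinates (hZm : ∀ i, Measurable (Z i))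
    (hZ : ∀ i, HasLaw (Z i) (stdGaussian (EuclideanSpace ℝ (Fin n))) P) (hind : iIndepFun Z P)
    (b : OrthonormalBasis (Fin n) ℝ (EuclideanSpace ℝ (Fin n))) {k₀ k : Fin n} (hk : k ≠ k₀)
    (i : Fin lam) :
    IndepFun (fun ω => fun j => (inner ℝ (b k₀) (Z j ω) : ℝ))
      (fun ω => (inner ℝ (b k) (Z i ω) : ℝ)) P := by
  have hW := iIndepFun_coordinates hZm hZ hind b
  refine indepFun_of_measurable_iSup hW (fun q => by have := hZm q.1; fun_prop)
    (S := {q | q.2 = k₀}) (T := {q | q.2 = k})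
    (Set.disjoint_left.2 fun q hq hq' => hk (hq'.symm.trans hq))
    (@measurable_pi_lambda _ _ _ (_) _ _ fun j => ?_) ?_
  · exact measurable_iSup_comap
      (fun (q : Fin lam × Fin n) ω => (inner ℝ (b q.2) (Z q.1 ω) : ℝ)) (i := (j, k₀)) rfl
  · exact measurable_iSup_comap
      (fun (q : Fin lam × Fin n) ω => (inner ℝ (b q.2) (Z q.1 ω) : ℝ)) (i := (i, k)) rfl

/-- A coordinate of the best step orthogonal to `a` has the moments of a standard normal
variable. -/
theorem integral_comp_bestStep_of_ne (hlam : 1 ≤ lam) (ha : a ≠ 0) (hZm : ∀ i, Measurable (Z i))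
    (hZ : ∀ i, HasLaw (Z i) (stdGaussian (EuclideanSpace ℝ (Fin n))) P) (hind : iIndepFun Z P)
    {b : OrthonormalBasis (Fin n) ℝ (EuclideanSpace ℝ (Fin n))} {k₀ k : Fin n}
    (hb : a = ‖a‖ • b k₀) (hk : k ≠ k₀) {φ : ℝ → ℝ} (hφ : Measurable φ)
    (hφi : Integrable φ (gaussianReal 0 1)) :
    ∫ ω, φ (inner ℝ (b k) (bestStep a fun i => Z i ω)) ∂P = ∫ x, φ x ∂gaussianReal 0 1 := by
  have hapos : 0 < ‖a‖ := norm_pos_iff.2 ha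
  have hmin : ∀ ω i j, (inner ℝ a (Z i ω) : ℝ) ≤ inner ℝ a (Z j ω) ↔
      (inner ℝ (b k₀) (Z i ω) : ℝ) ≤ inner ℝ (b k₀) (Z j ω) := fun ω i j => by
    rw [hb, inner_smul_left, inner_smul_left, RCLike.conj_to_real]
    exact mul_le_mul_iff_right₀ hapos
  have hae := ae_injective_inner ha hZm hZ hind
  -- Decomposition according to which child is selected. Each term then factors by independence, and
  -- the selection probabilities only have to sum to one; their individual values do not matter.
  have hdecomp : ∀ᵐ ω ∂P, φ (inner ℝ (b k) (bestStep a fun i => Z i ω)) =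
      ∑ i, minIndicator i (fun j => inner ℝ (b k₀) (Z j ω)) * φ (inner ℝ (b k) (Z i ω)) := by
    filter_upwards [hae] with ω hω
    obtain ⟨i, hi⟩ := exists_isMin hlam a fun i => Z i ω
    rw [bestStep_eq hω hi, ← sum_ite_isMin hω hi fun i => φ (inner ℝ (b k) (Z i ω))]
    refine Finset.sum_congr rfl fun i _ => ?_
    simp only [minIndicator, hmin, ite_mul, one_mul, zero_mul]
  have hone : ∀ᵐ ω ∂P, ∑ i, minIndicator i (fun j => inner ℝ (b k₀) (Z j ω)) = 1 := by
    filter_upwards [hae] with ω hω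
    obtain ⟨i, hi⟩ := exists_isMin hlam a fun i => Z i ω
    rw [← sum_ite_isMin hω hi fun _ => (1 : ℝ)]
    refine Finset.sum_congr rfl fun i _ => ?_
    simp only [minIndicator, hmin]
  have hWm : Measurable fun ω => fun j => (inner ℝ (b k₀) (Z j ω) : ℝ) :=
    measurable_pi_lambda _ fun j => by have := hZm j; fun_prop
  have hφint : ∀ i, Integrable (fun ω => φ (inner ℝ (b k) (Z i ω))) P := fun i => by
    have hl := hasLaw_coordinate (hZ i) b k
    rw [← hl.map_eq] at hφi
    exact (integrable_map_measure hφ.aestronglyMeasurable hl.aemeasurable).1 hφi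
  have hterm : ∀ i, Integrable (fun ω => minIndicator i (fun j => inner ℝ (b k₀) (Z j ω)) *
      φ (inner ℝ (b k) (Z i ω))) P := fun i =>
    (hφint i).bdd_mul (c := 1) ((measurable_minIndicator i).comp hWm).aestronglyMeasurable
      (ae_of_all _ fun ω => norm_minIndicator_le i fun j => inner ℝ (b k₀) (Z j ω))
  have hindint : ∀ i,
      Integrable (fun ω => minIndicator i (fun j => inner ℝ (b k₀) (Z j ω))) P := fun i =>
    (integrable_const (1 : ℝ)).mono' ((measurable_minIndicator i).comp hWm).aestronglyMeasurable
      (ae_of_all _ fun ω => norm_minIndicator_le i _)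
  rw [integral_congr_ae hdecomp, integral_finsetSum _ fun i _ => hterm i]
  have hfac : ∀ i, ∫ ω, minIndicator i (fun j => inner ℝ (b k₀) (Z j ω)) *
      φ (inner ℝ (b k) (Z i ω)) ∂P =
      (∫ ω, minIndicator i (fun j => inner ℝ (b k₀) (Z j ω)) ∂P) * ∫ x, φ x ∂gaussianReal 0 1 :=
    fun i => by
    have hl := hasLaw_coordinate (hZ i) b k
    rw [(indepFun_coordinates hZm hZ hind b hk i).integral_fun_comp_mul_comp
      (f := minIndicator i) (g := φ) hWm.aemeasurable hl.aemeasurable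
      (measurable_minIndicator i).aestronglyMeasurable hφ.aestronglyMeasurable,
      ← hl.integral_comp hφ.aestronglyMeasurable]
    rfl
  simp_rw [hfac]
  rw [← Finset.sum_mul, ← integral_finsetSum _ fun i _ => hindint i, integral_congr_ae hone]
  simp

/-- The coordinate of the best step along `a` is distributed as the smallest of `lam` standard
normal variables. -/
theorem integral_comp_bestStep_self (hlam : 1 ≤ lam) (ha : a ≠ 0) (hZm : ∀ i, Measurable (Z i))
    (hZ : ∀ i, HasLaw (Z i) (stdGaussian (EuclideanSpace ℝ (Fin n))) P) (hind : iIndepFun Z P)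
    {b : OrthonormalBasis (Fin n) ℝ (EuclideanSpace ℝ (Fin n))} {k₀ : Fin n}
    (hb : a = ‖a‖ • b k₀) {φ : ℝ → ℝ} (hφ : Measurable φ) :
    ∫ ω, φ (inner ℝ (b k₀) (bestStep a fun i => Z i ω)) ∂P = ∫ x, φ x ∂minNormalLaw lam := by
  have hapos : 0 < ‖a‖ := norm_pos_iff.2 ha
  have : Nonempty (Fin lam) := ⟨⟨0, by omega⟩⟩
  have hlaw : HasLaw (fun ω => fun j => (inner ℝ (b k₀) (Z j ω) : ℝ))
      (Measure.pi fun _ : Fin lam => gaussianReal 0 1) P :=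
    iIndepFun.hasLaw_pi (fun j => hasLaw_coordinate (hZ j) b k₀)
      (hind.comp (fun _ x => (inner ℝ (b k₀) x : ℝ)) fun _ => by fun_prop)
  have hmin : HasLaw (fun ω => ⨅ j, (inner ℝ (b k₀) (Z j ω) : ℝ)) (minNormalLaw lam) P :=
    HasLaw.fun_comp (Y := fun v : Fin lam → ℝ => ⨅ j, v j)
      ⟨measurable_iInf_fin.aemeasurable, rfl⟩ hlaw
  rw [← hmin.integral_comp hφ.aestronglyMeasurable]
  refine integral_congr_ae ?_
  filter_upwards [ae_injective_inner ha hZm hZ hind] with ω hω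
  obtain ⟨i, hi⟩ := exists_isMin hlam a fun i => Z i ω
  rw [bestStep_eq hω hi]
  simp only [Function.comp_apply]
  congr 1
  refine le_antisymm (le_ciInf fun j => ?_) (ciInf_le (Set.finite_range _).bddBelow i)
  have := hi j
  rw [hb, inner_smul_left, inner_smul_left, RCLike.conj_to_real] at this
  exact le_of_mul_le_mul_left this hapos

/-- By Parseval, since only the coordinate along `a` can have nonzero mean. -/
theorem sq_norm_integral_bestStep (hlam : 1 ≤ lam) (ha : a ≠ 0) (hZm : ∀ i, Measurable (Z i))
    (hZ : ∀ i, HasLaw (Z i) (stdGaussian (EuclideanSpace ℝ (Fin n))) P) (hind : iIndepFun Z P) :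
    ‖∫ ω, bestStep a (fun i => Z i ω) ∂P‖ ^ 2 = (∫ x, x ∂minNormalLaw lam) ^ 2 := by
  obtain ⟨b, k₀, hb⟩ := exists_orthonormalBasis_smul ha
  have hint := (memLp_bestStep a hZm hZ).integrable one_le_two
  rw [← b.sum_sq_inner_right, Finset.sum_eq_single k₀]
  · rw [← integral_inner hint]
    congr 1
    exact integral_comp_bestStep_self hlam ha hZm hZ hind hb measurable_id
  · intro k _ hk
    rw [← integral_inner hint]
    have := integral_comp_bestStep_of_ne hlam ha hZm hZ hind hb hk measurable_id
      IsGaussian.integrable_id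
    simp only [id] at this
    rw [this]
    simp
  · simp

/-- By Parseval, the coordinate along `a` contributes the second moment of the minimum and each of
the other `n - 1` coordinates contributes one. -/
theorem integral_sq_norm_bestStep (hlam : 1 ≤ lam) (ha : a ≠ 0) (hZm : ∀ i, Measurable (Z i))
    (hZ : ∀ i, HasLaw (Z i) (stdGaussian (EuclideanSpace ℝ (Fin n))) P) (hind : iIndepFun Z P) :
    ∫ ω, ‖bestStep a (fun i => Z i ω)‖ ^ 2 ∂P = (∫ x, x ^ 2 ∂minNormalLaw lam) + (n - 1) := by
  obtain ⟨b, k₀, hb⟩ := exists_orthonormalBasis_smul ha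
  have hmem := memLp_bestStep a hZm hZ
  simp_rw [← b.sum_sq_inner_right]
  rw [integral_finsetSum _ fun k _ => (hmem.const_inner (b k)).integrable_sq,
    ← Finset.add_sum_erase _ _ (Finset.mem_univ k₀)]
  congr 1
  · exact integral_comp_bestStep_self hlam ha hZm hZ hind hb (φ := fun x => x ^ 2) (by fun_prop)
  · rw [Finset.sum_congr rfl fun k hk => (integral_comp_bestStep_of_ne hlam ha hZm hZ hind hb
      (Finset.ne_of_mem_erase hk) (φ := fun x => x ^ 2) (by fun_prop)
      (memLp_id_gaussianReal' 2 (by simp)).integrable_sq).trans integral_sq_gaussianReal]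
    have hn : 1 ≤ n := k₀.pos
    simp [Nat.cast_sub hn]

end Moments

/-! ### Reduction of the algorithm to the linear path recursion -/

section Run

variable {n lam : ℕ}

/-- Strict monotonicity of `g` and positivity of the step-size cancel the parent, the step-size and
the offset from every comparison of children. The state thus disappears from the selection. -/
theorem selectedStep_eq_bestStep {g : ℝ → ℝ} (hg : StrictMono g)
    {a : EuclideanSpace ℝ (Fin n)} {b : ℝ} {f : EuclideanSpace ℝ (Fin n) → ℝ}
    (hf : ∀ x, f x = g (inner ℝ a x + b)) {select : (Fin lam → ℝ) → Fin lam}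
    (hselect : IsArgmin select) {s : State n} (hs : 0 < s.stepSize)
    {z : Fin lam → EuclideanSpace ℝ (Fin n)}
    (hinj : Function.Injective fun j => (inner ℝ a (z j) : ℝ)) :
    selectedStep f select s z = bestStep a z := by
  refine (bestStep_eq hinj fun j => ?_).symm
  have h : f (s.parent + s.stepSize • z (select fun i => f (s.parent + s.stepSize • z i))) ≤
      f (s.parent + s.stepSize • z j) := hselect (fun i => f (s.parent + s.stepSize • z i)) j
  generalize (select fun i => f (s.parent + s.stepSize • z i)) = i at h ⊢
  simp only [hf, hg.le_iff_le, inner_add_right, inner_smul_right, add_le_add_iff_left,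
    add_le_add_iff_right] at h
  exact le_of_mul_le_mul_left h hs

/-- Without ties, the run of the algorithm is driven by the best steps along `a`. -/
theorem run_path_stepSize {g : ℝ → ℝ} (hg : StrictMono g)
    {a : EuclideanSpace ℝ (Fin n)} {b : ℝ} {f : EuclideanSpace ℝ (Fin n) → ℝ}
    (hf : ∀ x, f x = g (inner ℝ a x + b)) {select : (Fin lam → ℝ) → Fin lam}
    (hselect : IsArgmin select) (c d : ℝ) {s₀ : State n} (hs₀ : 0 < s₀.stepSize)
    {z : ℕ → Fin lam → EuclideanSpace ℝ (Fin n)}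
    (hinj : ∀ t, Function.Injective fun j => (inner ℝ a (z t j) : ℝ)) (t : ℕ) :
    (run f select c d s₀ z t).path = cumulativePath c s₀.path (fun s => bestStep a (z s)) t ∧
    (run f select c d s₀ z t).stepSize = s₀.stepSize * Real.exp (∑ s ∈ Finset.range t,
      c / (2 * d) *
        (‖cumulativePath c s₀.path (fun s => bestStep a (z s)) (s + 1)‖ ^ 2 / n - 1)) := by
  induction t with
  | zero => simp [run, cumulativePath]
  | succ t ih =>
    obtain ⟨ih1, ih2⟩ := ih
    have hpos : 0 < (run f select c d s₀ z t).stepSize := by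
      rw [ih2]
      positivity
    have hsel := selectedStep_eq_bestStep hg hf hselect hpos (hinj t)
    have hpath : pathUpdate c (run f select c d s₀ z t).path
        (selectedStep f select (run f select c d s₀ z t) (z t)) =
        cumulativePath c s₀.path (fun s => bestStep a (z s)) (t + 1) := by
      rw [hsel, ih1]
      rfl
    refine ⟨hpath, ?_⟩
    simp only [run, step]
    rw [hpath, ih2, Finset.sum_range_succ, Real.exp_add, mul_assoc]
    rfl

/-- The restriction to `t ≥ 1` matters: at `t = 0` the left side is `0`, while the right side is `-c
/ (2 * d)`. -/
theorem log_stepSize_div {g : ℝ → ℝ} (hg : StrictMono g)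
    {a : EuclideanSpace ℝ (Fin n)} {b : ℝ} {f : EuclideanSpace ℝ (Fin n) → ℝ}
    (hf : ∀ x, f x = g (inner ℝ a x + b)) {select : (Fin lam → ℝ) → Fin lam}
    (hselect : IsArgmin select) (c d : ℝ) {s₀ : State n} (hs₀ : 0 < s₀.stepSize)
    {z : ℕ → Fin lam → EuclideanSpace ℝ (Fin n)}
    (hinj : ∀ t, Function.Injective fun j => (inner ℝ a (z t j) : ℝ)) {t : ℕ} (ht : 1 ≤ t) :
    1 / (t : ℝ) * Real.log ((run f select c d s₀ z t).stepSize / s₀.stepSize) =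
      c / (2 * d) * ((∑ s ∈ Finset.range t,
        ‖cumulativePath c s₀.path (fun s => bestStep a (z s)) (s + 1)‖ ^ 2) / t / n - 1) := by
  have ht' : (t : ℝ) ≠ 0 := by
    have : t ≠ 0 := by omega
    exact_mod_cast this
  rw [(run_path_stepSize hg hf hselect c d hs₀ hinj t).2, mul_div_cancel_left₀ _ hs₀.ne',
    Real.log_exp, ← Finset.mul_sum, Finset.sum_sub_distrib, ← Finset.sum_div]
  simp only [Finset.sum_const, Finset.card_range, nsmul_eq_mul, mul_one]
  field_simp

end Run

/-! ### The filtration of the noise and the value of the limit -/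

section Noise

variable {Ω E : Type*} [mΩ : MeasurableSpace Ω] [mE : MeasurableSpace E] {lam : ℕ}

/-- The noise indices used before iteration `t`. -/
def pastIndices (lam t : ℕ) : Set (Option (ℕ × Fin lam)) := {k | ∀ q, k = some q → q.1 < t}

/-- The filtration generated by the initial path and the random steps. -/
def noiseFiltration (W : Option (ℕ × Fin lam) → Ω → E) (hW : ∀ k, Measurable (W k)) :
    Filtration ℕ mΩ where
  seq t := ⨆ k ∈ pastIndices lam t, mE.comap (W k)
  mono' _ _ hst := biSup_mono fun _ hk q hq => (hk q hq).trans_le hst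
  le' _ := iSup₂_le fun k _ => (hW k).comap_le

variable {P : Measure Ω} [IsProbabilityMeasure P] {n : ℕ}

/-- Iteration `t` uses only the noise indices `(t, i)`, which are disjoint from the past, and every
iteration applies the same measurable function to an identically distributed family. -/
theorem isStepProcess_bestStep (a : EuclideanSpace ℝ (Fin n))
    {p : Ω → EuclideanSpace ℝ (Fin n)} {ξ : ℕ → Fin lam → Ω → EuclideanSpace ℝ (Fin n)}
    (hpl : HasLaw p (stdGaussian (EuclideanSpace ℝ (Fin n))) P)
    (hξm : ∀ t i, Measurable (ξ t i))
    (hξ : ∀ t i, HasLaw (ξ t i) (stdGaussian (EuclideanSpace ℝ (Fin n))) P)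
    (hWm : ∀ k, Measurable ((fun k : Option (ℕ × Fin lam) => k.elim p fun q => ξ q.1 q.2) k))
    (hind : iIndepFun (fun k : Option (ℕ × Fin lam) => k.elim p fun q => ξ q.1 q.2) P) :
    IsStepProcess P (noiseFiltration _ hWm) p fun t ω => bestStep a fun i => ξ t i ω := by
  set W := fun k : Option (ℕ × Fin lam) => k.elim p fun q => ξ q.1 q.2 with hWdef
  have hbest : ∀ t (S : Set (Option (ℕ × Fin lam))), (∀ i, some (t, i) ∈ S) →
      Measurable[⨆ k ∈ S, (inferInstance : MeasurableSpace _).comap (W k)]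
        fun ω => bestStep a fun i => ξ t i ω := fun t S hS =>
    (measurable_bestStep a).comp (@measurable_pi_lambda _ _ _ (_) _ _ fun i =>
      measurable_iSup_comap W (hS i))
  have hlaw : ∀ t, HasLaw (fun ω i => ξ t i ω)
      (Measure.pi fun _ : Fin lam => stdGaussian (EuclideanSpace ℝ (Fin n))) P := fun t =>
    iIndepFun.hasLaw_pi (hξ t) (hind.precomp (g := fun i => some (t, i)) fun i j hij => by
      simpa using hij)
  exact
  -- The index `none`, carrying the initial path, lies vacuously in every `pastIndices lam t`,
  -- including `t = 0`.
  { measurable_init := measurable_iSup_comap W (i := none) fun q hq => by simp at hq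
    measurable_step := fun t => hbest t _ fun i q hq => by
      obtain rfl := Option.some.inj hq
      exact Nat.lt_succ_self t
    indep := fun t => by
      have h := indep_iSup_of_disjoint (fun k => (hWm k).comap_le) hind
        (S := pastIndices lam t) (T := {k | ∃ i, k = some (t, i)})
        (Set.disjoint_left.2 fun k hk hk' => by
          obtain ⟨i, hi⟩ := hk'
          exact lt_irrefl t (hk _ hi))
      exact indep_of_indep_of_le_right h
        (hbest t {k | ∃ i, k = some (t, i)} fun i => ⟨i, rfl⟩).comap_le
    identDistrib := fun t =>
      (IdentDistrib.mk (hlaw t).aemeasurable (hlaw 0).aemeasurable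
        ((hlaw t).map_eq.trans (hlaw 0).map_eq.symm)).comp (measurable_bestStep a)
    memLp_init := memLp_of_hasLaw_stdGaussian hpl
    memLp_step := memLp_bestStep a (hξm 0) (hξ 0) }

/-- The `n - 1` unit second moments orthogonal to `a` almost cancel the normalization `-1` after
division by `n`, leaving `E N_{1:lam}² - 1`; the factor `c` cancels the `1 / c` in front of the
squared mean. -/
theorem limitSqNorm_bestStep (hlam : 1 ≤ lam) {a : EuclideanSpace ℝ (Fin n)} (ha : a ≠ 0)
    {ξ : ℕ → Fin lam → Ω → EuclideanSpace ℝ (Fin n)} (hξm : ∀ t i, Measurable (ξ t i))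
    (hξ : ∀ t i, HasLaw (ξ t i) (stdGaussian (EuclideanSpace ℝ (Fin n))) P)
    (hind : iIndepFun (ξ 0) P) {c d : ℝ} (hc : c ≠ 0) (hd : d ≠ 0) (hn : 0 < n) :
    c / (2 * d) *
        (IsStepProcess.limitSqNorm P c (fun t ω => bestStep a fun i => ξ t i ω) / n - 1) =
      rate n lam c d := by
  have hn' : (n : ℝ) ≠ 0 := by exact_mod_cast hn.ne'
  rw [IsStepProcess.limitSqNorm, sq_norm_integral_bestStep hlam ha (hξm 0) (hξ 0) hind,
    integral_sq_norm_bestStep hlam ha (hξm 0) (hξ 0) hind, rate]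
  field_simp
  ring

end Noise

end CSAES
end

/-! ### The main theorem -/

/-- The noise consists of `p₀` and all steps `ξ t i`, jointly independent and standard Gaussian in
`ℝⁿ`; `f` is a strictly increasing function of a nonconstant affine function (so `n ≥ 1`). -/
theorem mainTheorem1
    {Ω : Type*} [MeasurableSpace Ω] (P : Measure Ω) [IsProbabilityMeasure P]
    {n lam : ℕ} (hlam : 1 ≤ lam)
    (c d : ℝ) (hc0 : 0 < c) (hc1 : c ≤ 1) (hd : 0 < d)
    (g : ℝ → ℝ) (hg : StrictMono g)
    (a : EuclideanSpace ℝ (Fin n)) (ha : a ≠ 0) (b : ℝ)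
    (f : EuclideanSpace ℝ (Fin n) → ℝ) (hf : ∀ x, f x = g (inner ℝ a x + b))
    (select : (Fin lam → ℝ) → Fin lam) (hselect : CSAES.IsArgmin select)
    (X₀ : Ω → EuclideanSpace ℝ (Fin n))
    (σ₀ : Ω → ℝ) (hσ₀ : ∀ ω, 0 < σ₀ ω)
    (p₀ : Ω → EuclideanSpace ℝ (Fin n))
    (ξ : ℕ → Fin lam → Ω → EuclideanSpace ℝ (Fin n))
    (hp₀ : HasLaw p₀ (stdGaussian (EuclideanSpace ℝ (Fin n))) P)
    (hξ : ∀ t i, HasLaw (ξ t i) (stdGaussian (EuclideanSpace ℝ (Fin n))) P)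
    (hindep : iIndepFun
      (fun k : Option (ℕ × Fin lam) => k.elim p₀ (fun q => ξ q.1 q.2)) P)
    (σ : ℕ → Ω → ℝ)
    (hσ : ∀ t ω, σ t ω = (CSAES.run f select c d
      { parent := X₀ ω, stepSize := σ₀ ω, path := p₀ ω } (fun s i => ξ s i ω) t).stepSize) :
    -- almost sure convergence
    (∀ᵐ ω ∂P, Tendsto (fun t : ℕ => 1 / (t : ℝ) * Real.log (σ t ω / σ 0 ω)) atTop
      (𝓝 (CSAES.rate n lam c d))) ∧
    -- convergence in expectation
    (∀ t : ℕ, Integrable (fun ω => 1 / (t : ℝ) * Real.log (σ t ω / σ 0 ω)) P) ∧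
    Tendsto (fun t : ℕ => ∫ ω, 1 / (t : ℝ) * Real.log (σ t ω / σ 0 ω) ∂P) atTop
      (𝓝 (CSAES.rate n lam c d)) ∧
    -- positivity of the limit, and geometric divergence
    (2 ≤ lam → (c < 1 ∨ 3 ≤ lam) →
      0 < CSAES.rate n lam c d ∧
      ∀ᵐ ω ∂P, CSAES.GeometricallyDivergent (fun t => σ t ω)) := by
  have hn : 0 < n := by
    rcases Nat.eq_zero_or_pos n with rfl | h
    · exact absurd (Subsingleton.elim a 0) ha
    · exact h
  -- The laws only provide almost everywhere measurability. Measurable versions are needed for the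
  -- filtration; they keep the laws and the independence.
  let p' : Ω → EuclideanSpace ℝ (Fin n) := hp₀.aemeasurable.mk p₀
  let ξ' : ℕ → Fin lam → Ω → EuclideanSpace ℝ (Fin n) := fun t i =>
    (hξ t i).aemeasurable.mk (ξ t i)
  have hp' : p' =ᵐ[P] p₀ := hp₀.aemeasurable.ae_eq_mk.symm
  have hξ' : ∀ t i, ξ' t i =ᵐ[P] ξ t i := fun t i => (hξ t i).aemeasurable.ae_eq_mk.symm
  have hpm : Measurable p' := hp₀.aemeasurable.measurable_mk
  have hξm : ∀ t i, Measurable (ξ' t i) := fun t i => (hξ t i).aemeasurable.measurable_mk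
  have hpl := hp₀.congr hp'
  have hξl : ∀ t i, HasLaw (ξ' t i) (stdGaussian (EuclideanSpace ℝ (Fin n))) P :=
    fun t i => (hξ t i).congr (hξ' t i)
  have hind : iIndepFun (fun k : Option (ℕ × Fin lam) => k.elim p' fun q => ξ' q.1 q.2) P := by
    refine hindep.congr fun k => ?_
    rcases k with _ | q
    · exact hp'.symm
    · exact (hξ' q.1 q.2).symm
  have hWm : ∀ k, Measurable
      ((fun k : Option (ℕ × Fin lam) => k.elim p' fun q => ξ' q.1 q.2) k) := by
    rintro (_ | q)
    · exact hpm
    · exact hξm q.1 q.2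
  have hindt : ∀ t, iIndepFun (ξ' t) P := fun t =>
    hind.precomp (g := fun i => some (t, i)) fun i j hij => by simpa using hij
  have hstep := CSAES.isStepProcess_bestStep a hpl hξm hξl hWm hind
  have hrate := CSAES.limitSqNorm_bestStep hlam ha hξm hξl (hindt 0) hc0.ne' hd.ne' hn
  -- A single null set serves all `t`, as only countably many events are discarded. The right side
  -- involves neither `X₀`, `σ₀` nor `select`, so no measurability of these is required, even for
  -- integrability.
  have hlog : ∀ᵐ ω ∂P, ∀ t : ℕ, 1 ≤ t → 1 / (t : ℝ) * Real.log (σ t ω / σ 0 ω) =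
      c / (2 * d) * ((∑ s ∈ Finset.range t, ‖CSAES.cumulativePath c (p' ω)
        (fun s => CSAES.bestStep a fun i => ξ' s i ω) (s + 1)‖ ^ 2) / t / n - 1) := by
    have hinj : ∀ᵐ ω ∂P, ∀ t, Function.Injective fun j => (inner ℝ a (ξ' t j ω) : ℝ) :=
      ae_all_iff.2 fun t => CSAES.ae_injective_inner ha (hξm t) (hξl t) (hindt t)
    have hall : ∀ᵐ ω ∂P, ∀ t i, ξ' t i ω = ξ t i ω := by
      simp only [ae_all_iff]
      exact hξ'
    filter_upwards [hinj, hall, hp'] with ω h1 h2 h3 t ht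
    simp only [h2] at h1
    simp only [h2, h3, hσ]
    exact CSAES.log_stepSize_div hg hf hselect c d
      (s₀ := { parent := X₀ ω, stepSize := σ₀ ω, path := p₀ ω }) (hσ₀ ω) h1 ht
  have hmain : ∀ᵐ ω ∂P, Tendsto (fun t : ℕ => 1 / (t : ℝ) * Real.log (σ t ω / σ 0 ω)) atTop
      (𝓝 (CSAES.rate n lam c d)) := by
    filter_upwards [hlog, hstep.ae_tendsto_average_sq_norm_path hc0 hc1] with ω h1 h2
    rw [← hrate]
    refine (((h2.div_const (n : ℝ)).sub_const 1).const_mul (c / (2 * d))).congr' ?_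
    filter_upwards [eventually_ge_atTop 1] with t ht
    exact (h1 t ht).symm
  have hint : ∀ t : ℕ, Integrable (fun ω => c / (2 * d) * ((∑ s ∈ Finset.range t,
      ‖CSAES.cumulativePath c (p' ω) (fun s => CSAES.bestStep a fun i => ξ' s i ω) (s + 1)‖ ^ 2) /
        t / n - 1)) P := fun t =>
    (((hstep.integrable_average_sq_norm_path c t).div_const _).sub (integrable_const _)).const_mul _
  have hlog' : ∀ t : ℕ, 1 ≤ t → (fun ω => 1 / (t : ℝ) * Real.log (σ t ω / σ 0 ω)) =ᵐ[P]
      fun ω => c / (2 * d) * ((∑ s ∈ Finset.range t, ‖CSAES.cumulativePath c (p' ω)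
        (fun s => CSAES.bestStep a fun i => ξ' s i ω) (s + 1)‖ ^ 2) / t / n - 1) := fun t ht => by
    filter_upwards [hlog] with ω hω
    exact hω t ht
  refine ⟨hmain, fun t => ?_, ?_, fun h2 h3 => ?_⟩
  -- At `t = 0` the function is zero, because `1 / 0 = 0`.
  · rcases Nat.eq_zero_or_pos t with rfl | ht
    · simp
    · exact (hint t).congr (hlog' t ht).symm
  · rw [← hrate]
    refine (((hstep.tendsto_integral_average_sq_norm_path hc0 hc1).div_const (n : ℝ)).sub_const
      1 |>.const_mul (c / (2 * d))).congr' ?_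
    filter_upwards [eventually_ge_atTop 1] with t ht
    rw [integral_congr_ae (hlog' t ht), integral_const_mul, integral_sub
      ((hstep.integrable_average_sq_norm_path c t).div_const _) (integrable_const _)]
    simp [integral_div]
  · have hr := CSAES.rate_pos hn hc0 hc1 hd h2 h3
    refine ⟨hr, ?_⟩
    filter_upwards [hmain] with ω hω
    exact ⟨_, hr, hω⟩
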